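/- For an integer $\nu>1$ let $\mathcal H_\nu$ be the Hilbert space of holomorphic functions $f$ on the unit disc $\mathbb D$ with $$\|f\|_\nu^2=\frac{\nu-1}{\pi}\int_{\mathbb D}|f(z)|^2(1-|z|^2)^{\nu-2}\,dz<\infty .$$ Write $(a)_j=a(a+1)\cdots(a+j-1)$. Let $\mu,\nu>1$ and $k\ge 0$ be integers, and let $P_k\colon\mathcal H_\mu\otimes\mathcal H_\nu\to\mathcal H_{\mu+\nu+2k}$ (Hilbert space tensor product) be the bounded operator determined by $$P_k(f\otimes g)(\zeta)=C_{\mu,\nu,k}\sum_{j=0}^{k}(-1)^j\binom kj\frac{1}{(\mu)_j(\nu)_{k-j}}\,f^{(j)}(\zeta)\,g^{(k-j)}(\zeta),\qquad C_{\mu,\nu,k}=\left(\frac{(\mu)_k(\nu)_k}{k!\,(\mu+\nu+k-1)_k}\right)^{1/2}\!,$$ which satisfies $P_kP_k^*=I$, i.e. $P_k$ is the projection onto the component $\mathcal H_{\mu+\nu+2k}$ of $\mathcal H_\mu\otimes\mathcal H_\nu\cong\bigoplus_{k\ge0}\mathcal H_{\mu+\nu+2k}$. Define $$\mathcal T^\nu_{\mu,k}\colon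 B(\mathcal H_\mu)\to B(\mathcal H_{\mu+\nu+2k}),\qquad \mathcal T^\nu_{\mu,k}(A)=P_k(A\otimes I_\nu)P_k^*,$$ where $I_\nu$ is the identity on $\mathcal H_\nu$. Then $\mathcal T^\nu_{\mu,k}$ is completely positive. Moreover, if $A\in B(\mathcal H_\mu)$ is of trace class, then $\mathcal T^\nu_{\mu,k}(A)$ is of trace class, and $$\operatorname{Tr}\,\mathcal T^\nu_{\mu,k}(A)=\frac{\mu+\nu+2k-1}{\mu-1}\operatorname{Tr}A .$$ -/

import Mathlib

noncomputable section

namespace SU11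

open MeasureTheory Metric Complex
open scoped ComplexConjugate TensorProduct InnerProductSpace

/-- The open unit disc. -/
abbrev 𝔻 : Set ℂ := ball (0 : ℂ) 1

/-- The measure `dι_ν(z) = (1 - |z|²)^ν (ν - 1) dz / (π (1 - |z|²)²)` on the unit disc, where `dz` is
Lebesgue measure; it is regarded as a measure on `ℂ` that is carried by the disc. -/
def iota (ν : ℕ) : Measure ℂ :=
  (volume.restrict 𝔻).withDensity fun z =>
    ENNReal.ofReal ((1 - ‖z‖ ^ 2) ^ ν * ((ν - 1 : ℝ) / (Real.pi * (1 - ‖z‖ ^ 2) ^ 2)))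

/-- The holomorphic functions on the unit disc that are square integrable with respect to `dι_ν`. A
function on the disc is represented by its extension by zero to `ℂ`. -/
def holL2 (ν : ℕ) : Submodule ℂ (ℂ → ℂ) where
  carrier := {f | DifferentiableOn ℂ f 𝔻 ∧ (∀ z, z ∉ 𝔻 → f z = 0) ∧ MemLp f 2 (iota ν)}
  add_mem' {f g} hf hg :=
    ⟨hf.1.add hg.1, fun z hz => by simp [hf.2.1 z hz, hg.2.1 z hz], hf.2.2.add hg.2.2⟩
  zero_mem' := ⟨differentiableOn_const 0, fun _ _ => rfl, MemLp.zero⟩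
  smul_mem' c f hf :=
    ⟨hf.1.const_smul c, fun z hz => by simp [hf.2.1 z hz], hf.2.2.const_smul c⟩

/-- The weighted Bergman space `𝓗_ν`. -/
def Bergman (ν : ℕ) : Type := holL2 ν

instance (ν : ℕ) : AddCommGroup (Bergman ν) := inferInstanceAs (AddCommGroup (holL2 ν))

instance (ν : ℕ) : Module ℂ (Bergman ν) := inferInstanceAs (Module ℂ (holL2 ν))

instance (ν : ℕ) : FunLike (Bergman ν) ℂ ℂ where
  coe f := f.1
  coe_injective _ _ h := Subtype.ext h

section Space

variable {ν : ℕ}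

theorem coe_add (f g : Bergman ν) : ⇑(f + g) = ⇑f + ⇑g := rfl

theorem coe_smul (c : ℂ) (f : Bergman ν) : ⇑(c • f) = c • ⇑f := rfl

theorem coe_sub (f g : Bergman ν) : ⇑(f - g) = ⇑f - ⇑g := rfl

theorem diffOn (f : Bergman ν) : DifferentiableOn ℂ f 𝔻 := f.2.1

theorem eq_zero_of_notMem (f : Bergman ν) {z : ℂ} (hz : z ∉ 𝔻) : f z = 0 := f.2.2.1 z hz

theorem memLp (f : Bergman ν) : MemLp f 2 (iota ν) := f.2.2.2

theorem measurable_density (ν : ℕ) : Measurable fun z : ℂ =>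
    ENNReal.ofReal ((1 - ‖z‖ ^ 2) ^ ν * ((ν - 1 : ℝ) / (Real.pi * (1 - ‖z‖ ^ 2) ^ 2))) := by
  fun_prop

theorem one_sub_pos {z : ℂ} (hz : z ∈ 𝔻) : 0 < 1 - ‖z‖ ^ 2 := by
  have h : ‖z‖ < 1 := by simpa using hz
  nlinarith [norm_nonneg z]

theorem density_pos (hν : 1 < ν) {z : ℂ} (hz : z ∈ 𝔻) :
    0 < (1 - ‖z‖ ^ 2) ^ ν * ((ν - 1 : ℝ) / (Real.pi * (1 - ‖z‖ ^ 2) ^ 2)) := by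
  have h := one_sub_pos hz
  have h' : (0 : ℝ) < ν - 1 := by
    have : (1 : ℝ) < ν := by exact_mod_cast hν
    linarith
  have := Real.pi_pos
  positivity

theorem density_eq (m : ℕ) {z : ℂ} (hz : z ∈ 𝔻) :
    (1 - ‖z‖ ^ 2) ^ (m + 2) * ((((m + 2 : ℕ) : ℝ) - 1) / (Real.pi * (1 - ‖z‖ ^ 2) ^ 2))
      = (m + 1) / Real.pi * (1 - ‖z‖ ^ 2) ^ m := by
  have h := (one_sub_pos hz).ne'
  have := Real.pi_pos.ne'
  push_cast
  field_simp
  ring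

theorem volume_ac (hν : 1 < ν) : (volume.restrict 𝔻) ≪ iota ν := by
  refine withDensity_absolutelyContinuous' (measurable_density ν).aemeasurable ?_
  filter_upwards [ae_restrict_mem measurableSet_ball] with z hz
  simpa using density_pos hν hz

theorem integral_iota (ν : ℕ) (hν : 1 < ν) (g : ℂ → ℂ) : ∫ z, g z ∂iota ν =
    ∫ z in 𝔻, ((1 - ‖z‖ ^ 2) ^ ν * ((ν - 1 : ℝ) / (Real.pi * (1 - ‖z‖ ^ 2) ^ 2))) • g z := by
  rw [iota, integral_withDensity_eq_integral_toReal_smul (measurable_density ν) (by simp)]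
  refine setIntegral_congr_fun measurableSet_ball fun z hz => ?_
  rw [ENNReal.toReal_ofReal (density_pos hν hz).le]

theorem isFiniteMeasure_iota (hν : 1 < ν) : IsFiniteMeasure (iota ν) := by
  obtain ⟨m, rfl⟩ : ∃ m, ν = m + 2 := ⟨ν - 2, by omega⟩
  refine isFiniteMeasure_withDensity (ne_of_lt ?_)
  calc _ ≤ ∫⁻ z in 𝔻, ENNReal.ofReal ((m + 1) / Real.pi) := by
        refine setLIntegral_mono measurable_const fun z hz => ENNReal.ofReal_le_ofReal ?_
        rw [density_eq m hz]
        have h := one_sub_pos hz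
        have h1 : (1 - ‖z‖ ^ 2) ^ m ≤ 1 := pow_le_one₀ h.le (by nlinarith [norm_nonneg z])
        exact mul_le_of_le_one_right (by positivity) h1
    _ < ⊤ := by
        rw [setLIntegral_const]
        exact ENNReal.mul_lt_top ENNReal.ofReal_lt_top measure_ball_lt_top

theorem integrable_mul (f g : Bergman ν) : Integrable (fun z => conj (f z) * g z) (iota ν) :=
  (memLp f).star.integrable_mul (memLp g)

theorem eq_zero_of_ae (hν : 1 < ν) (f : Bergman ν) (h : f =ᵐ[iota ν] 0) : f = 0 := by
  have h1 : f =ᵐ[volume.restrict 𝔻] 0 := (volume_ac hν).ae_le h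
  have h2 := Measure.eqOn_open_of_ae_eq h1 isOpen_ball (diffOn f).continuousOn continuousOn_const
  refine DFunLike.ext _ _ fun z => ?_
  by_cases hz : z ∈ 𝔻
  · exact h2 hz
  · exact eq_zero_of_notMem f hz

/-- The inner product `⟨f, g⟩_ν = ∫ conj (f) g dι_ν`, conjugate linear in the first variable. -/
@[reducible]
def innerCore (hν : 1 < ν) : InnerProductSpace.Core ℂ (Bergman ν) where
  inner f g := ∫ z, conj (f z) * g z ∂iota ν
  conj_inner_symm f g := by
    rw [← integral_conj]
    simp [mul_comm]
  re_inner_nonneg f := by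
    have : ∀ z, conj (f z) * f z = ((‖f z‖ ^ 2 : ℝ) : ℂ) := fun z => by
      rw [Complex.conj_mul']; simp
    simp_rw [this, integral_complex_ofReal]
    exact integral_nonneg fun z => by positivity
  add_left f g h := by
    rw [← integral_add (integrable_mul f h) (integrable_mul g h)]
    simp [coe_add, add_mul]
  smul_left f g c := by
    rw [← integral_const_mul]
    simp [coe_smul, mul_assoc]
  definite f h := by
    have h1 : ∀ z, conj (f z) * f z = ((‖f z‖ ^ 2 : ℝ) : ℂ) := fun z => by
      rw [Complex.conj_mul']; simp
    simp_rw [h1, integral_complex_ofReal] at h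
    have h2 : ∫ z, ‖f z‖ ^ 2 ∂iota ν = 0 := by exact_mod_cast h
    rw [integral_eq_zero_iff_of_nonneg (fun z => by positivity)] at h2
    · refine eq_zero_of_ae hν f ?_
      filter_upwards [h2] with z hz
      simpa using hz
    · exact (memLp f).integrable_norm_pow (by norm_num)

end Space

instance (ν : ℕ) [h : Fact (1 < ν)] : NormedAddCommGroup (Bergman ν) :=
  @InnerProductSpace.Core.toNormedAddCommGroup ℂ (Bergman ν) _ _ _ (innerCore h.out)

instance (ν : ℕ) [h : Fact (1 < ν)] : InnerProductSpace ℂ (Bergman ν) :=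
  InnerProductSpace.ofCore (innerCore h.out).toCore

theorem inner_def {ν : ℕ} [Fact (1 < ν)] (f g : Bergman ν) :
    ⟪f, g⟫_ℂ = ∫ z, conj (f z) * g z ∂iota ν := rfl

section Coefficients

variable {ν : ℕ}

theorem integral_beta (m n : ℕ) :
    ∫ r in (0 : ℝ)..1, 2 * (m + 1) * r ^ (2 * n + 1) * (1 - r ^ 2) ^ m =
      (n.factorial : ℝ) / ((m + 2).ascFactorial n : ℝ) := by
  induction n with
  | zero =>
    have h := intervalIntegral.integral_eq_sub_of_hasDerivAt (a := 0) (b := 1)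
      (f := fun r : ℝ => -(1 - r ^ 2) ^ (m + 1))
      (f' := fun r : ℝ => 2 * (m + 1) * r ^ (2 * 0 + 1) * (1 - r ^ 2) ^ m)
      (fun r _ => by
        have := ((((hasDerivAt_id r).pow 2).const_sub 1).pow (m + 1)).neg
        refine this.congr_deriv ?_
        simp
        ring) (by apply Continuous.intervalIntegrable; fun_prop)
    rw [h]
    simp
  | succ n ih =>
    have h := intervalIntegral.integral_eq_sub_of_hasDerivAt (a := 0) (b := 1)
      (f := fun r : ℝ => r ^ (2 * n + 2) * (1 - r ^ 2) ^ (m + 1))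
      (f' := fun r : ℝ => (n + 1) / (m + 1) * (2 * (m + 1) * r ^ (2 * n + 1) * (1 - r ^ 2) ^ m)
        - (n + m + 2) / (m + 1) * (2 * (m + 1) * r ^ (2 * (n + 1) + 1) * (1 - r ^ 2) ^ m))
      (fun r _ => by
        have := (hasDerivAt_pow (2 * n + 2) r).mul
          ((((hasDerivAt_id r).pow 2).const_sub 1).pow (m + 1))
        refine this.congr_deriv ?_
        simp
        have : (m : ℝ) + 1 ≠ 0 := by positivity
        field_simp
        ring) (by apply Continuous.intervalIntegrable; fun_prop)
    rw [intervalIntegral.integral_sub (by apply Continuous.intervalIntegrable; fun_prop)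
      (by apply Continuous.intervalIntegrable; fun_prop),
      intervalIntegral.integral_const_mul, intervalIntegral.integral_const_mul, ih] at h
    simp only [one_pow, sub_self, ne_eq, Nat.add_eq_zero_iff, one_ne_zero, and_false,
      not_false_eq_true, zero_pow, mul_zero, OfNat.ofNat_ne_zero, zero_mul] at h
    have h1 : (m : ℝ) + 1 ≠ 0 := by positivity
    have h2 : (m : ℝ) + 2 + n ≠ 0 := by positivity
    have h3 : (((m + 2).ascFactorial n : ℕ) : ℝ) ≠ 0 := by
      exact_mod_cast (Nat.ascFactorial_pos _ _).ne'
    rw [Nat.ascFactorial_succ, Nat.factorial_succ]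
    push_cast at h ⊢
    field_simp at h ⊢
    linarith

/-- The Taylor coefficients at the origin. -/
def coeff (f : ℂ → ℂ) (n : ℕ) : ℂ := iteratedDeriv n f 0 / n.factorial

theorem angular (f : Bergman ν) (n : ℕ) {r : ℝ} (h0 : 0 < r) (h1 : r < 1) :
    ∫ θ in Set.Ioo (-Real.pi) Real.pi,
      conj ((r * exp (θ * I)) ^ n) * f (r * exp (θ * I)) =
      2 * Real.pi * r ^ (2 * n) * coeff f n := by
  have hd : DifferentiableOn ℂ f (closedBall 0 r) :=
    (diffOn f).mono (closedBall_subset_ball h1)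
  have h := DifferentiableOn.circleIntegral_one_div_sub_center_pow_smul h0 n hd
  have hr : (r : ℂ) ≠ 0 := by exact_mod_cast h0.ne'
  have hper : Function.Periodic (fun θ : ℝ =>
      conj ((r * exp (θ * I)) ^ n) * f (r * exp (θ * I))) (2 * Real.pi) := by
    intro θ
    have : exp (((θ + 2 * Real.pi : ℝ) : ℂ) * I) = exp (θ * I) := by
      have := Complex.exp_periodic (θ * I)
      rw [← this]
      congr 1
      push_cast
      ring
    simp only [this]
  rw [← integral_Ioc_eq_integral_Ioo, ← intervalIntegral.integral_of_le (by linarith [Real.pi_pos])]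
  have h2 := hper.intervalIntegral_add_eq (-Real.pi) 0
  rw [show -Real.pi + 2 * Real.pi = Real.pi by ring, zero_add] at h2
  rw [h2]
  rw [circleIntegral] at h
  have h3 : ∀ θ : ℝ, deriv (circleMap 0 r) θ •
      (1 / (circleMap 0 r θ - 0) ^ (n + 1)) • f (circleMap 0 r θ) =
      (I / r ^ (2 * n)) * (conj ((r * exp (θ * I)) ^ n) * f (r * exp (θ * I))) := by
    intro θ
    have hc : conj (exp (θ * I)) = (exp (θ * I))⁻¹ := by
      rw [← exp_conj, ← exp_neg]
      simp
    have he := exp_ne_zero (θ * I)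
    simp only [deriv_circleMap, circleMap, zero_add, sub_zero, smul_eq_mul, map_pow, map_mul, hc,
      conj_ofReal]
    simp only [mul_pow, inv_pow]
    field_simp
    ring
  simp_rw [h3] at h
  rw [intervalIntegral.integral_const_mul] at h
  have hI := I_ne_zero
  rw [coeff]
  rw [smul_eq_mul, div_mul_eq_mul_div, div_mul_eq_mul_div, div_eq_iff (by positivity)] at h
  apply mul_left_cancel₀ hI
  rw [h]
  ring

theorem mem_disc_polar {r : ℝ} (h0 : 0 < r) (θ : ℝ) : (r * exp (θ * I) : ℂ) ∈ 𝔻 ↔ r < 1 := by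
  simp [abs_of_pos h0, Complex.norm_exp_ofReal_mul_I]

theorem integral_monomial_mul (hν : 1 < ν) (f : Bergman ν) (n : ℕ) :
    ∫ z, conj (z ^ n) * f z ∂iota ν = (n.factorial : ℂ) / (ν.ascFactorial n : ℂ) * coeff f n := by
  obtain ⟨m, rfl⟩ : ∃ m, ν = m + 2 := ⟨ν - 2, by omega⟩
  set ρ : ℝ → ℝ := fun r => (m + 1) / Real.pi * (1 - r ^ 2) ^ m with hρ
  set G : ℂ → ℂ := fun z => ρ ‖z‖ • (conj (z ^ n) * f z) with hG
  have hfin := isFiniteMeasure_iota hν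
  have hGc : ContinuousOn G 𝔻 := by
    have := (diffOn f).continuousOn
    simp only [hG, hρ]
    fun_prop
  have hint : IntegrableOn G 𝔻 := by
    have hI : Integrable (fun z => conj (z ^ n) * f z) (iota (m + 2)) := by
      refine ((memLp f).integrable (by norm_num)).norm.mono' ?_ ?_
      · refine AEStronglyMeasurable.mul ?_ (memLp f).1
        exact Continuous.aestronglyMeasurable (by fun_prop)
      · refine (withDensity_absolutelyContinuous _ _).ae_le ?_
        filter_upwards [ae_restrict_mem measurableSet_ball] with z hz
        have hz' : ‖z‖ ≤ 1 := by simpa using (mem_ball_zero_iff.1 hz).le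
        simp only [map_pow, norm_mul, norm_pow, RCLike.norm_conj]
        exact mul_le_of_le_one_left (norm_nonneg _) (pow_le_one₀ (norm_nonneg _) hz')
    rw [iota, integrable_withDensity_iff_integrable_smul' (measurable_density _) (by simp)] at hI
    refine hI.congr ?_
    filter_upwards [ae_restrict_mem measurableSet_ball] with z hz
    rw [ENNReal.toReal_ofReal (density_pos hν hz).le, density_eq m hz]
  rw [integral_iota _ hν]
  have e1 : ∫ z in 𝔻, ((1 - ‖z‖ ^ 2) ^ (m + 2) *
      ((((m + 2 : ℕ) : ℝ) - 1) / (Real.pi * (1 - ‖z‖ ^ 2) ^ 2))) • (conj (z ^ n) * f z)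
      = ∫ z in 𝔻, G z := by
    refine setIntegral_congr_fun measurableSet_ball fun z hz => ?_
    simp only [hG, hρ]
    rw [density_eq m hz]
  rw [e1, ← integral_indicator measurableSet_ball, ← Complex.integral_comp_polarCoord_symm]
  have hsymm : ∀ p : ℝ × ℝ, (Complex.polarCoord.symm p : ℂ) = p.1 * exp (p.2 * I) := fun p => by
    rw [Complex.polarCoord_symm_apply, exp_mul_I]
    push_cast
    rfl
  set S : Set (ℝ × ℝ) := Set.Ioo 0 1 ×ˢ Set.Ioo (-Real.pi) Real.pi with hS
  have hSm : MeasurableSet S := measurableSet_Ioo.prod measurableSet_Ioo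
  have hST : S ⊆ polarCoord.target := by
    rintro ⟨r, θ⟩ ⟨hr, hθ⟩
    exact ⟨hr.1, hθ⟩
  have e2 : ∀ p ∈ polarCoord.target, p.1 • (𝔻.indicator G) (Complex.polarCoord.symm p) =
      S.indicator (fun p : ℝ × ℝ => p.1 • G (p.1 * exp (p.2 * I))) p := by
    rintro ⟨r, θ⟩ ⟨hr, hθ⟩
    have hr' : 0 < r := hr
    rw [hsymm]
    by_cases h1 : r < 1
    · rw [Set.indicator_of_mem ((mem_disc_polar hr' θ).2 h1), Set.indicator_of_mem]
      exact ⟨⟨hr', h1⟩, hθ⟩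
    · rw [Set.indicator_of_notMem (fun h => h1 ((mem_disc_polar hr' θ).1 h)),
        Set.indicator_of_notMem (fun h => h1 h.1.2), smul_zero]
  have hTm : MeasurableSet polarCoord.target := polarCoord.open_target.measurableSet
  rw [setIntegral_congr_fun hTm e2, setIntegral_indicator hSm, Set.inter_eq_right.2 hST]
  have hcont : ContinuousOn (fun p : ℝ × ℝ => p.1 • G (p.1 * exp (p.2 * I))) S := by
    refine ContinuousOn.smul continuousOn_fst (hGc.comp (by fun_prop) ?_)
    rintro ⟨r, θ⟩ ⟨hr, hθ⟩
    exact (mem_disc_polar hr.1 θ).2 hr.2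
  have hintS : IntegrableOn (fun p : ℝ × ℝ => p.1 • G (p.1 * exp (p.2 * I))) S := by
    refine ⟨hcont.aestronglyMeasurable hSm, ?_⟩
    have hlt : ∫⁻ z, 𝔻.indicator (fun z => ‖G z‖ₑ) z < ⊤ := by
      rw [lintegral_indicator measurableSet_ball]
      exact hint.2
    rw [← Complex.lintegral_comp_polarCoord_symm] at hlt
    refine lt_of_le_of_lt ?_ hlt
    refine le_trans ?_ (lintegral_mono_set hST)
    refine setLIntegral_mono' hSm ?_
    rintro ⟨r, θ⟩ ⟨hr, hθ⟩
    rw [hsymm, Set.indicator_of_mem ((mem_disc_polar hr.1 θ).2 hr.2), enorm_smul]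
    simp only [smul_eq_mul]
    rw [Real.enorm_eq_ofReal hr.1.le]
  rw [hS] at hintS ⊢
  rw [Measure.volume_eq_prod] at hintS ⊢
  rw [setIntegral_prod _ hintS]
  have e3 : ∀ r ∈ Set.Ioo (0 : ℝ) 1, ∫ θ in Set.Ioo (-Real.pi) Real.pi,
      r • G (r * exp (θ * I)) =
      ((2 * (m + 1) * r ^ (2 * n + 1) * (1 - r ^ 2) ^ m : ℝ) : ℂ) * coeff f n := by
    intro r hr
    have hn : ∀ θ : ℝ, ‖(r * exp (θ * I) : ℂ)‖ = r := fun θ => by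
      simp [abs_of_pos hr.1, Complex.norm_exp_ofReal_mul_I]
    simp only [hG, hn]
    simp_rw [integral_smul]
    rw [angular f n hr.1 hr.2]
    simp only [hρ, real_smul]
    have := Real.pi_pos.ne'
    have hpi : (Real.pi : ℂ) ≠ 0 := by exact_mod_cast this
    push_cast
    field_simp
    ring
  rw [setIntegral_congr_fun measurableSet_Ioo e3, integral_mul_const, integral_complex_ofReal,
    ← integral_Ioc_eq_integral_Ioo, ← intervalIntegral.integral_of_le zero_le_one, integral_beta]
  push_cast
  rfl

end Coefficients

section Basis

variable {ν : ℕ}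

/-- The monomial `z ^ n` as an element of `𝓗_ν`. -/
def monomial (ν : ℕ) [h : Fact (1 < ν)] (n : ℕ) : Bergman ν :=
  ⟨𝔻.indicator fun z => z ^ n,
    (differentiableOn_pow n).congr fun _ hz => Set.indicator_of_mem hz _,
    fun _ hz => Set.indicator_of_notMem hz _, by
      have := isFiniteMeasure_iota h.out
      refine MemLp.of_bound (C := 1) ?_ ?_
      · exact ((continuous_pow n).stronglyMeasurable.indicator
          measurableSet_ball).aestronglyMeasurable
      · refine Filter.Eventually.of_forall fun z => ?_
        by_cases hz : z ∈ 𝔻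
        · rw [Set.indicator_of_mem hz, norm_pow]
          exact pow_le_one₀ (norm_nonneg _) (mem_ball_zero_iff.1 hz).le
        · rw [Set.indicator_of_notMem hz]
          simp⟩

theorem monomial_apply (ν : ℕ) [Fact (1 < ν)] (n : ℕ) {z : ℂ} (hz : z ∈ 𝔻) :
    monomial ν n z = z ^ n := Set.indicator_of_mem hz _

theorem iteratedDeriv_monomial (ν : ℕ) [Fact (1 < ν)] (n j : ℕ) {z : ℂ} (hz : z ∈ 𝔻) :
    iteratedDeriv j (monomial ν n) z = n.descFactorial j * z ^ (n - j) := by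
  have h : (monomial ν n : ℂ → ℂ) =ᶠ[nhds z] fun z => z ^ n := by
    filter_upwards [isOpen_ball.mem_nhds hz] with w hw
    exact monomial_apply ν n hw
  rw [h.iteratedDeriv_eq, iteratedDeriv_eq_iterate, iter_deriv_pow]
  rw [Nat.descFactorial_eq_prod_range]
  push_cast
  congr 1
  by_cases hj : j ≤ n
  · refine Finset.prod_congr rfl fun i hi => ?_
    rw [Nat.cast_sub]
    have := Finset.mem_range.1 hi
    omega
  · push Not at hj
    rw [Finset.prod_eq_zero (Finset.mem_range.2 hj) (by simp),
      Finset.prod_eq_zero (Finset.mem_range.2 hj) (by simp)]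

theorem coeff_monomial (ν : ℕ) [Fact (1 < ν)] (n j : ℕ) :
    coeff (monomial ν n) j = if n = j then 1 else 0 := by
  rw [coeff, iteratedDeriv_monomial ν n j (by simp)]
  have hf : ((j.factorial : ℕ) : ℂ) ≠ 0 := by exact_mod_cast j.factorial_ne_zero
  rcases lt_trichotomy n j with h | h | h
  · rw [Nat.descFactorial_eq_zero_iff_lt.2 h, if_neg h.ne]
    simp
  · subst h
    simp [Nat.descFactorial_self, hf]
  · rw [if_neg h.ne', zero_pow (by omega)]
    simp

/-- The weight `(ν)_n / n!`, the inverse of the squared norm of `z ^ n`. -/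
def wt (ν n : ℕ) : ℝ := (ν.ascFactorial n : ℝ) / n.factorial

theorem wt_pos (ν : ℕ) [h : Fact (1 < ν)] (n : ℕ) : 0 < wt ν n := by
  have : 0 < ν.ascFactorial n := by
    obtain ⟨m, rfl⟩ : ∃ m, ν = m + 1 := ⟨ν - 1, by have := h.out; omega⟩
    exact Nat.ascFactorial_pos _ _
  have h2 := n.factorial_pos
  unfold wt
  positivity

theorem wt_succ (ν n : ℕ) : (n + 1) * wt ν (n + 1) = (ν + n) * wt ν n := by
  have h2 : (n.factorial : ℝ) ≠ 0 := by exact_mod_cast n.factorial_ne_zero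
  have h3 : (n : ℝ) + 1 ≠ 0 := by positivity
  rw [wt, wt, Nat.ascFactorial_succ, Nat.factorial_succ]
  push_cast
  field_simp

theorem inner_monomial [h : Fact (1 < ν)] (n : ℕ) (f : Bergman ν) :
    ⟪monomial ν n, f⟫_ℂ = ((wt ν n)⁻¹ : ℝ) * coeff f n := by
  have e : ∫ z, conj (monomial ν n z) * f z ∂iota ν = ∫ z, conj (z ^ n) * f z ∂iota ν := by
    refine integral_congr_ae (Filter.Eventually.of_forall fun z => ?_)
    by_cases hz : z ∈ 𝔻
    · simp only [monomial_apply ν n hz]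
    · simp only [eq_zero_of_notMem f hz, mul_zero]
  rw [inner_def, e, integral_monomial_mul h.out, wt]
  push_cast
  rw [inv_div]

/-- The normalized monomials. -/
def e (ν : ℕ) [Fact (1 < ν)] (n : ℕ) : Bergman ν := ((Real.sqrt (wt ν n) : ℝ) : ℂ) • monomial ν n

theorem inner_e [h : Fact (1 < ν)] (n : ℕ) (f : Bergman ν) :
    ⟪e ν n, f⟫_ℂ = ((Real.sqrt (wt ν n))⁻¹ : ℝ) * coeff f n := by
  rw [e, inner_smul_left, inner_monomial, ← mul_assoc, conj_ofReal, ← ofReal_mul]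
  congr 2
  have h1 := wt_pos ν n
  have h2 := Real.sqrt_pos.2 h1
  field_simp
  rw [Real.sq_sqrt h1.le]

theorem orthonormal_e (ν : ℕ) [h : Fact (1 < ν)] : Orthonormal ℂ (e ν) := by
  rw [orthonormal_iff_ite]
  intro i j
  rw [inner_e]
  have h1 : coeff (e ν j) i = (Real.sqrt (wt ν j) : ℂ) * coeff (monomial ν j) i := by
    have h0 : (e ν j : ℂ → ℂ) =ᶠ[nhds 0] (fun z => (Real.sqrt (wt ν j) : ℂ) * z ^ j) := by
      filter_upwards [isOpen_ball.mem_nhds (mem_ball_self one_pos)] with w hw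
      simp only [e, coe_smul, Pi.smul_apply, smul_eq_mul, monomial_apply ν j hw]
    have h0' : (monomial ν j : ℂ → ℂ) =ᶠ[nhds 0] (fun z => z ^ j) := by
      filter_upwards [isOpen_ball.mem_nhds (mem_ball_self one_pos)] with w hw
      exact monomial_apply ν j hw
    rw [coeff, coeff, h0.iteratedDeriv_eq, h0'.iteratedDeriv_eq, iteratedDeriv_const_mul_field,
      mul_div_assoc]
  rw [h1, coeff_monomial]
  have h2 := (Real.sqrt_pos.2 (wt_pos ν i)).ne'
  have h3 : ((Real.sqrt (wt ν i) : ℝ) : ℂ) ≠ 0 := by exact_mod_cast h2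
  by_cases hij : i = j
  · subst hij
    simp [h3]
  · rw [if_neg hij, if_neg (fun h => hij h.symm)]
    simp

theorem hasSum_coeff (f : Bergman ν) {z : ℂ} (hz : z ∈ 𝔻) :
    HasSum (fun n => coeff f n * z ^ n) (f z) := by
  have h := hasSum_taylorSeries_on_ball (diffOn f) hz
  have h2 : (fun n => coeff f n * z ^ n) =
      fun n : ℕ => (n.factorial : ℂ)⁻¹ • (z - 0) ^ n • iteratedDeriv n f 0 := by
    funext n
    simp only [coeff, smul_eq_mul, sub_zero]
    ring
  rw [h2]
  exact h

theorem wt_eq_choose (m n : ℕ) : wt (m + 1) n = ((n + m).choose m : ℝ) := by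
  have h2 : (n.factorial : ℝ) ≠ 0 := by exact_mod_cast n.factorial_ne_zero
  rw [wt, Nat.ascFactorial_eq_factorial_mul_choose, add_comm m n, Nat.choose_symm_add]
  push_cast
  field_simp

theorem one_le_wt (ν : ℕ) [h : Fact (1 < ν)] (n : ℕ) : 1 ≤ wt ν n := by
  obtain ⟨m, rfl⟩ : ∃ m, ν = m + 1 := ⟨ν - 1, by have := h.out; omega⟩
  rw [wt_eq_choose]
  exact_mod_cast Nat.choose_pos (by omega)

theorem summable_wt (ν : ℕ) [h : Fact (1 < ν)] {r : ℝ} (h0 : 0 ≤ r) (h1 : r < 1) :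
    Summable fun n => wt ν n * r ^ n := by
  obtain ⟨m, rfl⟩ : ∃ m, ν = m + 1 := ⟨ν - 1, by have := h.out; omega⟩
  simp_rw [wt_eq_choose]
  exact summable_choose_mul_geometric_of_norm_lt_one m (by rwa [Real.norm_of_nonneg h0])

theorem norm_coeff_le [h : Fact (1 < ν)] (f : Bergman ν) (n : ℕ) :
    ‖coeff f n‖ ≤ wt ν n * ‖f‖ := by
  have h1 := inner_e n f
  have h2 : ‖⟪e ν n, f⟫_ℂ‖ ≤ ‖f‖ := by
    have := norm_inner_le_norm (𝕜 := ℂ) (e ν n) f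
    rwa [(orthonormal_e ν).1 n, one_mul] at this
  have h3 := Real.sqrt_pos.2 (wt_pos ν n)
  rw [h1, norm_mul, Complex.norm_real, Real.norm_of_nonneg (by positivity),
    inv_mul_le_iff₀ h3] at h2
  refine h2.trans (mul_le_mul_of_nonneg_right ?_ (norm_nonneg _))
  rw [Real.sqrt_le_left (wt_pos ν n).le]
  nlinarith [one_le_wt ν n]

/-- Point evaluations are bounded, uniformly on smaller discs. -/
theorem exists_bound (ν : ℕ) [Fact (1 < ν)] {r : ℝ} (h0 : 0 ≤ r) (h1 : r < 1) :
    ∃ K : ℝ, 0 ≤ K ∧ ∀ (f : Bergman ν) (z : ℂ), ‖z‖ ≤ r → ‖f z‖ ≤ K * ‖f‖ := by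
  refine ⟨∑' n, wt ν n * r ^ n, tsum_nonneg fun n => ?_, fun f z hz => ?_⟩
  · have := wt_pos ν n
    positivity
  have hs := summable_wt ν h0 h1
  have hzd : z ∈ 𝔻 := mem_ball_zero_iff.2 (hz.trans_lt h1)
  rw [← (hasSum_coeff f hzd).tsum_eq, ← tsum_mul_right]
  refine tsum_of_norm_bounded (hs.mul_right ‖f‖).hasSum fun n => ?_
  rw [norm_mul, norm_pow]
  calc ‖coeff f n‖ * ‖z‖ ^ n ≤ (wt ν n * ‖f‖) * r ^ n := by
        have := wt_pos ν n
        gcongr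
        exact norm_coeff_le f n
    _ = _ := by ring

/-- The inclusion of `𝓗_ν` in `L²(dι_ν)`. -/
def toL2 (ν : ℕ) [Fact (1 < ν)] : Bergman ν →ₗᵢ[ℂ] Lp ℂ 2 (iota ν) where
  toFun f := (memLp f).toLp f
  map_add' f g := MemLp.toLp_add (memLp f) (memLp g)
  map_smul' c f := MemLp.toLp_const_smul c (memLp f)
  norm_map' f := by
    have h : ⟪(memLp f).toLp f, (memLp f).toLp f⟫_ℂ = ⟪f, f⟫_ℂ := by
      rw [L2.inner_def, inner_def]
      refine integral_congr_ae ?_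
      filter_upwards [(memLp f).coeFn_toLp] with z hz
      rw [hz, RCLike.inner_apply, mul_comm]
    rw [inner_self_eq_norm_sq_to_K, inner_self_eq_norm_sq_to_K] at h
    have h' : ‖(memLp f).toLp f‖ ^ 2 = ‖f‖ ^ 2 := by exact_mod_cast h
    exact (pow_left_inj₀ (norm_nonneg _) (norm_nonneg _) two_ne_zero).1 h'

theorem toL2_coeFn [Fact (1 < ν)] (f : Bergman ν) : toL2 ν f =ᵐ[iota ν] f :=
  (memLp f).coeFn_toLp

theorem isClosed_range_toL2 (ν : ℕ) [h : Fact (1 < ν)] : IsClosed (Set.range (toL2 ν)) := by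
  refine isClosed_of_closure_subset fun F hF => ?_
  obtain ⟨u, hu, hlim⟩ := mem_closure_iff_seq_limit.1 hF
  choose f hf using hu
  have hcau : CauchySeq f := by
    have : CauchySeq (fun n => toL2 ν (f n)) := by
      simp_rw [hf]
      exact hlim.cauchySeq
    refine (toL2 ν).isometry.isUniformInducing.cauchy_map_iff.1 ?_
    rw [Filter.map_map]
    exact this
  have hunif : ∀ r : ℝ, 0 ≤ r → r < 1 →
      UniformCauchySeqOn (fun n => (f n : ℂ → ℂ)) Filter.atTop (closedBall 0 r) := by
    intro r h0 h1
    obtain ⟨K, hK, hb⟩ := exists_bound ν h0 h1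
    rw [Metric.uniformCauchySeqOn_iff]
    intro ε hε
    obtain ⟨N, hN⟩ := Metric.cauchySeq_iff.1 hcau (ε / (K + 1)) (by positivity)
    refine ⟨N, fun m hm n hn z hz => ?_⟩
    have hz' : ‖z‖ ≤ r := by simpa using hz
    have h2 := hb (f m - f n) z hz'
    have h3 := hN m hm n hn
    rw [dist_eq_norm] at h3 ⊢
    rw [coe_sub, Pi.sub_apply] at h2
    rw [lt_div_iff₀ (by positivity)] at h3
    nlinarith [norm_nonneg (f m - f n)]
  have hpt : ∀ z : ℂ, ∃ w, Filter.Tendsto (fun n => f n z) Filter.atTop (nhds w) := by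
    intro z
    by_cases hz : z ∈ 𝔻
    · exact cauchySeq_tendsto_of_complete
        ((hunif ‖z‖ (norm_nonneg z) (mem_ball_zero_iff.1 hz)).cauchySeq (by simp))
    · exact ⟨0, by simp [eq_zero_of_notMem _ hz]⟩
  choose g hg using hpt
  have hloc : TendstoLocallyUniformlyOn (fun n => (f n : ℂ → ℂ)) g Filter.atTop 𝔻 := by
    refine tendstoLocallyUniformlyOn_iff_forall_isCompact isOpen_ball |>.2 fun K hKs hK => ?_
    obtain ⟨r, hr1, hr⟩ : ∃ r < 1, K ⊆ closedBall (0 : ℂ) r := by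
      rcases K.eq_empty_or_nonempty with rfl | hne
      · exact ⟨0, one_pos, by simp⟩
      · obtain ⟨z, hz, hmax⟩ := hK.exists_isMaxOn hne continuous_norm.continuousOn
        exact ⟨‖z‖, mem_ball_zero_iff.1 (hKs hz), fun w hw => by simpa using hmax hw⟩
    refine TendstoUniformlyOn.mono ?_ (hr.trans (closedBall_subset_closedBall (le_max_left r 0)))
    exact (hunif _ (le_max_right r 0) (max_lt hr1 one_pos)).tendstoUniformlyOn_of_tendsto
      fun z _ => hg z
  have hgd : DifferentiableOn ℂ g 𝔻 :=
    hloc.differentiableOn (Filter.Eventually.of_forall fun n => diffOn (f n)) isOpen_ball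
  have hg0 : ∀ z, z ∉ 𝔻 → g z = 0 := fun z hz =>
    tendsto_nhds_unique (hg z) (by simp [eq_zero_of_notMem _ hz])
  have hae : F =ᵐ[iota ν] g := by
    obtain ⟨ns, hns, hsub⟩ := (tendstoInMeasure_of_tendsto_Lp hlim).exists_seq_tendsto_ae
    have hall : ∀ᵐ z ∂iota ν, ∀ n, (u n : ℂ → ℂ) z = f n z := by
      rw [ae_all_iff]
      intro n
      rw [← hf n]
      exact toL2_coeFn (f n)
    filter_upwards [hsub, hall] with z hz1 hz2
    simp_rw [hz2] at hz1
    exact tendsto_nhds_unique hz1 ((hg z).comp hns.tendsto_atTop)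
  have hgL : MemLp g 2 (iota ν) := (Lp.memLp F).ae_eq hae
  refine ⟨(⟨g, hgd, hg0, hgL⟩ : holL2 ν), ?_⟩
  refine Lp.ext ?_
  exact (MemLp.coeFn_toLp hgL).trans hae.symm

instance (ν : ℕ) [Fact (1 < ν)] : CompleteSpace (Bergman ν) :=
  (completeSpace_iff_isComplete_range (toL2 ν).isometry.isUniformInducing).2
    (isClosed_range_toL2 ν).isComplete

/-- The orthonormal basis of normalized monomials. -/
def basis (ν : ℕ) [Fact (1 < ν)] : HilbertBasis ℕ ℂ (Bergman ν) :=
  HilbertBasis.mkOfOrthogonalEqBot (orthonormal_e ν) <| by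
    rw [Submodule.eq_bot_iff]
    intro f hf
    have h : ∀ n, coeff f n = 0 := fun n => by
      have h1 : ⟪e ν n, f⟫_ℂ = 0 := hf _ (Submodule.subset_span ⟨n, rfl⟩)
      rw [inner_e] at h1
      have h2 := (Real.sqrt_pos.2 (wt_pos ν n)).ne'
      rcases mul_eq_zero.1 h1 with h3 | h3
      · exact absurd (by exact_mod_cast h3) (inv_ne_zero h2)
      · exact h3
    refine DFunLike.ext _ _ fun z => ?_
    by_cases hz : z ∈ 𝔻
    · have := hasSum_coeff f hz
      simp_rw [h, zero_mul] at this
      exact this.unique hasSum_zero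
    · exact eq_zero_of_notMem f hz

theorem basis_apply (ν : ℕ) [Fact (1 < ν)] (n : ℕ) : basis ν n = e ν n :=
  congrFun (HilbertBasis.coe_mkOfOrthogonalEqBot (orthonormal_e ν) _) n

end Basis

section Combinatorics

/-- The constant `C_{μ,ν,k}`, the inverse of the norm of `(z - w) ^ k` in `𝓗_μ ⊗ 𝓗_ν`; it is given by
`C_{μ,ν,k}⁻² = k! (μ + ν + k - 1)_k / ((μ)_k (ν)_k)`. -/
def cst (μ ν k : ℕ) : ℝ :=
  Real.sqrt ((μ.ascFactorial k * ν.ascFactorial k : ℝ) /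
    (k.factorial * (μ + ν + k - 1).ascFactorial k))

/-- The `j`-th coefficient of the transvectant. -/
def tcoef (μ ν k j : ℕ) : ℝ :=
  (-1) ^ j * k.choose j / (μ.ascFactorial j * ν.ascFactorial (k - j))

/-- The value at `1` of the transvectant of `z ^ a` and `z ^ b`. -/
def tau (μ ν k a b : ℕ) : ℝ :=
  ∑ j ∈ Finset.range (k + 1), tcoef μ ν k j * (a.descFactorial j * b.descFactorial (k - j))

theorem desc_lower (a j : ℕ) :
    (a : ℝ) * (a - 1).descFactorial j = (a - j) * a.descFactorial j := by
  rcases a with _ | a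
  · rcases j with _ | j <;> simp
  · have h := Nat.succ_descFactorial a j
    by_cases hj : j ≤ a + 1
    · have h2 : (((a + 1 - j : ℕ) * (a + 1).descFactorial j : ℕ) : ℝ) =
        ((a + 1) * a.descFactorial j : ℕ) := by exact_mod_cast h
      push_cast [Nat.cast_sub hj] at h2
      simp only [Nat.add_sub_cancel]
      push_cast
      linarith
    · have h1 : (a + 1).descFactorial j = 0 := Nat.descFactorial_eq_zero_iff_lt.2 (by omega)
      have h2 : a.descFactorial j = 0 := Nat.descFactorial_eq_zero_iff_lt.2 (by omega)
      simp [h1, h2]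

theorem desc_succ (a j : ℕ) :
    (a.descFactorial (j + 1) : ℝ) = (a - j) * a.descFactorial j := by
  rw [Nat.descFactorial_succ]
  by_cases hj : j ≤ a
  · push_cast [Nat.cast_sub hj]
    rfl
  · have h2 : a.descFactorial j = 0 := Nat.descFactorial_eq_zero_iff_lt.2 (by omega)
    simp [h2]

theorem desc_raise (μ a j : ℕ) :
    ((a : ℝ) + μ) * (a + 1).descFactorial j =
      (a + μ + j) * a.descFactorial j + j * (μ + j - 1) * a.descFactorial (j - 1) := by
  rcases j with _ | j
  · simp
  · rw [Nat.succ_descFactorial_succ, desc_succ, Nat.add_sub_cancel]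
    push_cast
    ring

theorem tau_lower (μ ν k a b : ℕ) :
    (a : ℝ) * tau μ ν k (a - 1) b + b * tau μ ν k a (b - 1) =
      ((a : ℝ) + b - k) * tau μ ν k a b := by
  simp only [tau, Finset.mul_sum, ← Finset.sum_add_distrib]
  refine Finset.sum_congr rfl fun j hj => ?_
  have hj' : j ≤ k := by have := Finset.mem_range.1 hj; omega
  have h1 := desc_lower a j
  have h2 := desc_lower b (k - j)
  rw [Nat.cast_sub hj'] at h2
  linear_combination tcoef μ ν k j * b.descFactorial (k - j) * h1 +
    tcoef μ ν k j * a.descFactorial j * h2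

theorem asc_pos (μ : ℕ) [h : Fact (1 < μ)] (j : ℕ) : (0 : ℝ) < μ.ascFactorial j := by
  obtain ⟨m, rfl⟩ : ∃ m, μ = m + 1 := ⟨μ - 1, by have := h.out; omega⟩
  exact_mod_cast Nat.ascFactorial_pos _ _

theorem tcoef_succ (μ ν k j : ℕ) [Fact (1 < μ)] [Fact (1 < ν)] (hj : j < k) :
    tcoef μ ν k (j + 1) * ((j + 1) * (μ + j)) =
      -(tcoef μ ν k j * ((k - j : ℕ) * (ν + (k - j : ℕ) - 1))) := by
  obtain ⟨i, rfl⟩ : ∃ i, k = j + 1 + i := ⟨k - (j + 1), by omega⟩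
  have e1 : j + 1 + i - (j + 1) = i := by omega
  have e2 : j + 1 + i - j = i + 1 := by omega
  rw [tcoef, tcoef, e1, e2, Nat.ascFactorial_succ, Nat.ascFactorial_succ]
  have h1 := (asc_pos μ j).ne'
  have h2 := (asc_pos ν i).ne'
  have h3 : (μ : ℝ) + j ≠ 0 := by
    have : (1 : ℝ) < μ := by exact_mod_cast (Fact.out : 1 < μ)
    positivity
  have h4 : (ν : ℝ) + i ≠ 0 := by
    have : (1 : ℝ) < ν := by exact_mod_cast (Fact.out : 1 < ν)
    positivity
  have h5 : (((j + 1 + i).choose (j + 1) : ℕ) : ℝ) * (j + 1) = (j + 1 + i).choose j * (i + 1) := by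
    have := Nat.choose_succ_right_eq (j + 1 + i) j
    rw [e2] at this
    exact_mod_cast this
  push_cast
  rw [show (ν : ℝ) + (i + 1) - 1 = ν + i by ring]
  field_simp
  rw [pow_succ]
  linear_combination (-1) ^ j * (-1) * h5

theorem tau_raise (μ ν k a b : ℕ) [Fact (1 < μ)] [Fact (1 < ν)] :
    ((a : ℝ) + μ) * tau μ ν k (a + 1) b + (b + ν) * tau μ ν k a (b + 1) =
      ((a : ℝ) + b + μ + ν + k) * tau μ ν k a b := by
  set q : ℕ → ℝ := fun j => tcoef μ ν k j *
    (j * (μ + j - 1) * a.descFactorial (j - 1) * b.descFactorial (k - j)) with hq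
  set s : ℕ → ℝ := fun j => tcoef μ ν k j *
    ((k - j : ℕ) * (ν + (k - j : ℕ) - 1) * a.descFactorial j * b.descFactorial (k - j - 1)) with hs
  have h0 : ((a : ℝ) + μ) * tau μ ν k (a + 1) b + (b + ν) * tau μ ν k a (b + 1) =
      ((a : ℝ) + b + μ + ν + k) * tau μ ν k a b +
        ∑ j ∈ Finset.range (k + 1), (q j + s j) := by
    simp only [tau, Finset.mul_sum, ← Finset.sum_add_distrib]
    refine Finset.sum_congr rfl fun j hj => ?_
    have hj' : j ≤ k := by have := Finset.mem_range.1 hj; omega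
    have h1 := desc_raise μ a j
    have h2 := desc_raise ν b (k - j)
    simp only [hq, hs]
    rw [Nat.cast_sub hj'] at h2 ⊢
    linear_combination tcoef μ ν k j * b.descFactorial (k - j) * h1 +
      tcoef μ ν k j * a.descFactorial j * h2
  have h1 : ∑ j ∈ Finset.range (k + 1), (q j + s j) = 0 := by
    rw [Finset.sum_add_distrib, Finset.sum_range_succ', Finset.sum_range_succ s]
    have hq0 : q 0 = 0 := by simp [hq]
    have hsk : s k = 0 := by simp [hs]
    rw [hq0, hsk, add_zero, add_zero, ← Finset.sum_add_distrib]
    refine Finset.sum_eq_zero fun j hj => ?_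
    have := tcoef_succ μ ν k j (Finset.mem_range.1 hj)
    simp only [hq, hs]
    rw [Nat.add_sub_cancel, show k - (j + 1) = k - j - 1 by omega]
    push_cast
    linear_combination a.descFactorial j * b.descFactorial (k - j - 1) * this
  rw [h0, h1, add_zero]

/-- The squared norm of the `n`-th vector before normalization. -/
def nrm (μ ν k n : ℕ) : ℝ :=
  ∑ p ∈ Finset.HasAntidiagonal.antidiagonal (n + k), tau μ ν k p.1 p.2 ^ 2 * (wt μ p.1 * wt ν p.2)

theorem nrm_succ (μ ν k n : ℕ) [Fact (1 < μ)] [Fact (1 < ν)] :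
    (n + 1) * nrm μ ν k (n + 1) = ((μ + ν + 2 * k : ℕ) + n) * nrm μ ν k n := by
  have h1 : (n + 1) * nrm μ ν k (n + 1) =
      ∑ p ∈ Finset.HasAntidiagonal.antidiagonal (n + k + 1),
        (p.1 * tau μ ν k (p.1 - 1) p.2 * tau μ ν k p.1 p.2 * (wt μ p.1 * wt ν p.2) +
        p.2 * tau μ ν k p.1 (p.2 - 1) * tau μ ν k p.1 p.2 * (wt μ p.1 * wt ν p.2)) := by
    rw [nrm, Finset.mul_sum, show n + 1 + k = n + k + 1 by omega]
    refine Finset.sum_congr rfl fun p hp => ?_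
    have h := tau_lower μ ν k p.1 p.2
    have hp' : (p.1 : ℝ) + p.2 = n + k + 1 := by exact_mod_cast Finset.HasAntidiagonal.mem_antidiagonal.1 hp
    rw [hp'] at h
    linear_combination -(tau μ ν k p.1 p.2 * (wt μ p.1 * wt ν p.2)) * h
  rw [h1, Finset.sum_add_distrib, Finset.Nat.sum_antidiagonal_succ,
    Finset.Nat.sum_antidiagonal_succ', nrm, Finset.mul_sum]
  simp only [Nat.cast_zero, zero_mul, zero_add, Nat.add_sub_cancel]
  rw [← Finset.sum_add_distrib]
  refine Finset.sum_congr rfl fun p hp => ?_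
  have h := tau_raise μ ν k p.1 p.2
  have hp' : (p.1 : ℝ) + p.2 = n + k := by exact_mod_cast Finset.HasAntidiagonal.mem_antidiagonal.1 hp
  rw [hp'] at h
  have w1 := wt_succ μ p.1
  have w2 := wt_succ ν p.2
  push_cast
  linear_combination tau μ ν k p.1 p.2 * tau μ ν k (p.1 + 1) p.2 * wt ν p.2 * w1 +
    tau μ ν k p.1 p.2 * tau μ ν k p.1 (p.2 + 1) * wt μ p.1 * w2 +
    tau μ ν k p.1 p.2 * wt μ p.1 * wt ν p.2 * h

theorem tau_diag (μ ν a b : ℕ) :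
    tau μ ν (a + b) a b = (-1) ^ a * (a + b).factorial / (μ.ascFactorial a * ν.ascFactorial b) := by
  rw [tau, Finset.sum_eq_single_of_mem a (by simp)]
  · rw [tcoef, Nat.add_sub_cancel_left, Nat.descFactorial_self, Nat.descFactorial_self]
    have : ((a + b).choose a * (a.factorial * b.factorial) : ℝ) = (a + b).factorial := by
      have := Nat.add_choose_mul_factorial_mul_factorial a b
      rw [← Nat.choose_symm_add] at this
      rw [← mul_assoc]
      exact_mod_cast this
    rw [← this]
    ring
  · intro j hj hja
    have hj' : j < a + b + 1 := Finset.mem_range.1 hj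
    rcases lt_or_gt_of_ne hja with h | h
    · rw [Nat.descFactorial_eq_zero_iff_lt.2 (show b < a + b - j by omega)]
      simp
    · rw [Nat.descFactorial_eq_zero_iff_lt.2 h]
      simp

theorem nrm_zero (μ ν k : ℕ) [hμ : Fact (1 < μ)] [hν : Fact (1 < ν)] :
    cst μ ν k ^ 2 * nrm μ ν k 0 = 1 := by
  obtain ⟨m, rfl⟩ : ∃ m, μ = m + 1 := ⟨μ - 1, by have := hμ.out; omega⟩
  obtain ⟨n, rfl⟩ : ∃ n, ν = n + 1 := ⟨ν - 1, by have := hν.out; omega⟩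
  have fr : ∀ i : ℕ, (i.factorial : ℝ) ≠ 0 := fun i => by exact_mod_cast i.factorial_ne_zero
  have asc : ∀ l i : ℕ, ((l + 1).ascFactorial i : ℝ) = (l + i).factorial / l.factorial := by
    intro l i
    rw [eq_div_iff (fr l), mul_comm]
    exact_mod_cast Nat.factorial_mul_ascFactorial l i
  have key : nrm (m + 1) (n + 1) k 0 * ((m + 1).ascFactorial k * (n + 1).ascFactorial k : ℝ) =
      k.factorial * (m + 1 + (n + 1) + k - 1).ascFactorial k := by
    have e : m + 1 + (n + 1) + k - 1 = (m + n + k) + 1 := by omega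
    rw [e, Nat.ascFactorial_eq_factorial_mul_choose (m + n + k), show m + n + k + k = (n + k) + (m + k) by ring,
      Nat.add_choose_eq, nrm, zero_add]
    push_cast
    rw [Finset.sum_mul, Finset.mul_sum, Finset.mul_sum]
    refine Finset.sum_congr rfl fun p hp => ?_
    obtain ⟨a, b⟩ := p
    have hk : a + b = k := Finset.HasAntidiagonal.mem_antidiagonal.1 hp
    subst hk
    simp only
    rw [tau_diag, wt, wt, asc, asc, asc, asc,
      Nat.cast_choose ℝ (show a ≤ n + (a + b) by omega),
      Nat.cast_choose ℝ (show b ≤ m + (a + b) by omega),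
      show n + (a + b) - a = n + b by omega, show m + (a + b) - b = m + a by omega]
    have := fr a; have := fr b; have := fr m; have := fr n; have := fr (m + a); have := fr (n + b)
    have := fr (a + b); have := fr (m + (a + b)); have := fr (n + (a + b))
    field_simp
    rw [← pow_mul, mul_comm a 2, pow_mul]
    simp
  have h1 := asc_pos (m + 1) k
  have h2 := asc_pos (n + 1) k
  have h3 : (0 : ℝ) < k.factorial * (m + 1 + (n + 1) + k - 1).ascFactorial k := by
    have e : m + 1 + (n + 1) + k - 1 = (m + n + k) + 1 := by omega
    rw [e]
    exact_mod_cast Nat.mul_pos k.factorial_pos (Nat.ascFactorial_pos _ _)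
  rw [cst, Real.sq_sqrt (by positivity), div_mul_eq_mul_div, mul_comm, key, div_self h3.ne']

theorem nrm_eq (μ ν k n : ℕ) [Fact (1 < μ)] [Fact (1 < ν)] :
    cst μ ν k ^ 2 * nrm μ ν k n = wt (μ + ν + 2 * k) n := by
  induction n with
  | zero => rw [nrm_zero]; simp [wt]
  | succ n ih =>
    have h1 := nrm_succ μ ν k n
    have h2 := wt_succ (μ + ν + 2 * k) n
    have h3 : (n : ℝ) + 1 ≠ 0 := by positivity
    apply mul_left_cancel₀ h3
    rw [h2, ← ih]
    linear_combination cst μ ν k ^ 2 * h1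

end Combinatorics

instance (μ ν k : ℕ) [h : Fact (1 < μ)] : Fact (1 < μ + ν + 2 * k) :=
  ⟨by have := h.out; omega⟩

/-- The Hilbert space tensor product: the completion of the algebraic tensor product with respect to
the inner product `⟨x ⊗ y, x' ⊗ y'⟩ = ⟨x, x'⟩ ⟨y, y'⟩`. -/
abbrev HTensor (E F : Type) [NormedAddCommGroup E] [InnerProductSpace ℂ E] [NormedAddCommGroup F]
    [InnerProductSpace ℂ F] : Type :=
  UniformSpace.Completion (E ⊗[ℂ] F)

/-- The elementary tensor `x ⊗ y` in the Hilbert space tensor product. -/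
def htmul {E F : Type} [NormedAddCommGroup E] [InnerProductSpace ℂ E] [NormedAddCommGroup F]
    [InnerProductSpace ℂ F] (x : E) (y : F) : HTensor E F :=
  ((x ⊗ₜ[ℂ] y : E ⊗[ℂ] F) : UniformSpace.Completion (E ⊗[ℂ] F))

/-- The operator `A ⊗ I_F` on the Hilbert space tensor product, the continuous extension of
`x ⊗ y ↦ A x ⊗ y`. -/
def tensorId {E : Type} (F : Type) [NormedAddCommGroup E] [InnerProductSpace ℂ E]
    [NormedAddCommGroup F] [InnerProductSpace ℂ F] (A : E →L[ℂ] E) :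
    HTensor E F →L[ℂ] HTensor E F :=
  (A.rTensor F).completion

theorem tensorId_htmul {E : Type} (F : Type) [NormedAddCommGroup E] [InnerProductSpace ℂ E]
    [NormedAddCommGroup F] [InnerProductSpace ℂ F] (A : E →L[ℂ] E) (x : E) (y : F) :
    tensorId F A (htmul x y) = htmul (A x) y :=
  ContinuousLinearMap.completion_apply_coe _ _

theorem tensorId_add {E : Type} (F : Type) [NormedAddCommGroup E] [InnerProductSpace ℂ E]
    [NormedAddCommGroup F] [InnerProductSpace ℂ F] (A B : E →L[ℂ] E) :
    tensorId F (A + B) = tensorId F A + tensorId F B := by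
  refine ContinuousLinearMap.ext fun x => ?_
  induction x using UniformSpace.Completion.induction_on with
  | hp => exact isClosed_eq (by fun_prop) (by fun_prop)
  | ih x =>
    simp [tensorId, ContinuousLinearMap.completion_apply_coe, ContinuousLinearMap.rTensor_add,
      UniformSpace.Completion.coe_add, -ContinuousLinearMap.rTensor_apply]

theorem tensorId_smul {E : Type} (F : Type) [NormedAddCommGroup E] [InnerProductSpace ℂ E]
    [NormedAddCommGroup F] [InnerProductSpace ℂ F] (c : ℂ) (A : E →L[ℂ] E) :
    tensorId F (c • A) = c • tensorId F A := by
  refine ContinuousLinearMap.ext fun x => ?_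
  induction x using UniformSpace.Completion.induction_on with
  | hp => exact isClosed_eq (tensorId F (c • A)).continuous (c • tensorId F A).continuous
  | ih x =>
    change ((c • A).rTensor F).completion (x : HTensor E F) = c • (A.rTensor F).completion x
    rw [ContinuousLinearMap.completion_apply_coe, ContinuousLinearMap.completion_apply_coe,
      ContinuousLinearMap.rTensor_smul, ← UniformSpace.Completion.coe_smul]
    rfl

section Projection

variable {μ ν k : ℕ} [Fact (1 < μ)] [Fact (1 < ν)]

theorem orthonormal_htmul (μ ν : ℕ) [Fact (1 < μ)] [Fact (1 < ν)] :
    Orthonormal ℂ fun p : ℕ × ℕ => htmul (e μ p.1) (e ν p.2) := by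
  rw [orthonormal_iff_ite]
  rintro ⟨a, b⟩ ⟨a', b'⟩
  simp only [htmul, UniformSpace.Completion.inner_coe, TensorProduct.inner_tmul]
  rw [orthonormal_iff_ite.1 (orthonormal_e μ), orthonormal_iff_ite.1 (orthonormal_e ν)]
  by_cases h1 : a = a' <;> by_cases h2 : b = b' <;> simp [h1, h2]

/-- Coefficients of the embedding of `𝓗_{μ+ν+2k}` in `𝓗_μ ⊗ 𝓗_ν`. -/
def cf (μ ν k n : ℕ) (p : ℕ × ℕ) : ℝ :=
  cst μ ν k * tau μ ν k p.1 p.2 * Real.sqrt (wt μ p.1 * wt ν p.2 / wt (μ + ν + 2 * k) n)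

/-- Images of the normalized monomials in `𝓗_μ ⊗ 𝓗_ν`. -/
def vec (μ ν k : ℕ) [Fact (1 < μ)] [Fact (1 < ν)] (n : ℕ) : HTensor (Bergman μ) (Bergman ν) :=
  ∑ p ∈ Finset.HasAntidiagonal.antidiagonal (n + k), (cf μ ν k n p : ℂ) • htmul (e μ p.1) (e ν p.2)

theorem inner_vec_htmul (n : ℕ) (p : ℕ × ℕ) :
    ⟪vec μ ν k n, htmul (e μ p.1) (e ν p.2)⟫_ℂ = if p.1 + p.2 = n + k then (cf μ ν k n p : ℂ) else 0 := by
  have h := orthonormal_iff_ite.1 (orthonormal_htmul μ ν)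
  rw [vec, sum_inner]
  simp only [inner_smul_left, h, conj_ofReal, mul_ite, mul_one, mul_zero]
  rw [Finset.sum_ite_eq']
  simp [Finset.HasAntidiagonal.mem_antidiagonal]

theorem orthonormal_vec (μ ν k : ℕ) [Fact (1 < μ)] [Fact (1 < ν)] : Orthonormal ℂ (vec μ ν k) := by
  rw [orthonormal_iff_ite]
  intro m n
  have h0 : ⟪vec μ ν k m, vec μ ν k n⟫_ℂ = ∑ p ∈ Finset.HasAntidiagonal.antidiagonal (n + k),
      (cf μ ν k n p : ℂ) * if p.1 + p.2 = m + k then (cf μ ν k m p : ℂ) else 0 := by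
    conv_lhs => rw [vec.eq_1 μ ν k n, inner_sum]
    refine Finset.sum_congr rfl fun p _ => ?_
    rw [inner_smul_right, inner_vec_htmul]
  rw [h0]
  by_cases hmn : m = n
  · subst hmn
    rw [if_pos rfl]
    have h1 : ∀ p ∈ Finset.HasAntidiagonal.antidiagonal (m + k),
        ((cf μ ν k m p : ℂ) * if p.1 + p.2 = m + k then (cf μ ν k m p : ℂ) else 0) =
        ((cst μ ν k ^ 2 * (tau μ ν k p.1 p.2 ^ 2 * (wt μ p.1 * wt ν p.2)) /
          wt (μ + ν + 2 * k) m : ℝ) : ℂ) := by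
      intro p hp
      rw [if_pos (Finset.HasAntidiagonal.mem_antidiagonal.1 hp), ← ofReal_mul]
      congr 1
      have w1 := wt_pos μ p.1
      have w2 := wt_pos ν p.2
      have w3 := wt_pos (μ + ν + 2 * k) m
      have := Real.mul_self_sqrt (show 0 ≤ wt μ p.1 * wt ν p.2 / wt (μ + ν + 2 * k) m by positivity)
      rw [cf]
      linear_combination (cst μ ν k * tau μ ν k p.1 p.2) ^ 2 * this
    rw [Finset.sum_congr rfl h1, ← ofReal_sum, ← Finset.sum_div, ← Finset.mul_sum]
    have := nrm_eq μ ν k m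
    rw [nrm] at this
    rw [this, div_self (wt_pos _ _).ne', ofReal_one]
  · rw [if_neg hmn]
    refine Finset.sum_eq_zero fun p hp => ?_
    have := Finset.HasAntidiagonal.mem_antidiagonal.1 hp
    rw [if_neg (by omega), mul_zero]

/-- The isometric embedding of `𝓗_{μ+ν+2k}` in `𝓗_μ ⊗ 𝓗_ν`. -/
def emb (μ ν k : ℕ) [Fact (1 < μ)] [Fact (1 < ν)] :
    Bergman (μ + ν + 2 * k) →ₗᵢ[ℂ] HTensor (Bergman μ) (Bergman ν) :=
  ((orthonormal_vec μ ν k).orthogonalFamily.linearIsometry).comp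
    (basis (μ + ν + 2 * k)).repr.toLinearIsometry

theorem emb_e (n : ℕ) : emb μ ν k (e (μ + ν + 2 * k) n) = vec μ ν k n := by
  rw [← basis_apply]
  change (orthonormal_vec μ ν k).orthogonalFamily.linearIsometry
    ((basis (μ + ν + 2 * k)).repr (basis (μ + ν + 2 * k) n)) = _
  rw [HilbertBasis.repr_self, OrthogonalFamily.linearIsometry_apply_single]
  simp

/-- Derivatives at a point of the disc are bounded functionals. -/
theorem exists_derivFunctional (ν : ℕ) [Fact (1 < ν)] (j : ℕ) {ζ : ℂ} (hζ : ζ ∈ 𝔻) :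
    ∃ D : Bergman ν →L[ℂ] ℂ, ∀ f, D f = iteratedDeriv j f ζ := by
  have hζ' : ‖ζ‖ < 1 := mem_ball_zero_iff.1 hζ
  set R := (1 - ‖ζ‖) / 2 with hR
  have hR0 : 0 < R := by rw [hR]; linarith
  have hr1 : ‖ζ‖ + R < 1 := by rw [hR]; linarith
  obtain ⟨K, hK, hb⟩ := exists_bound ν (r := ‖ζ‖ + R) (by positivity) hr1
  have hcd : ∀ f : Bergman ν, ContDiffAt ℂ j f ζ := fun f =>
    ((diffOn f).analyticAt (isOpen_ball.mem_nhds hζ)).contDiffAt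
  refine ⟨LinearMap.mkContinuous
    { toFun := fun f => iteratedDeriv j f ζ
      map_add' := fun f g => iteratedDeriv_add (hcd f) (hcd g)
      map_smul' := fun c f => by
        rw [coe_smul, iteratedDeriv_const_smul_field]
        rfl } (j.factorial * K / R ^ j) ?_, fun f => rfl⟩
  intro f
  have hsub : closedBall ζ R ⊆ 𝔻 := by
    intro z hz
    have h1 : ‖z - ζ‖ ≤ R := by simpa [dist_eq_norm] using hz
    have h2 : ‖z‖ ≤ ‖z - ζ‖ + ‖ζ‖ := by simpa using norm_add_le (z - ζ) ζ
    exact mem_ball_zero_iff.2 (by linarith)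
  have h := norm_iteratedDeriv_le_of_forall_mem_sphere_norm_le (C := K * ‖f‖) j hR0
    (((diffOn f).mono hsub).diffContOnCl_ball subset_rfl) (fun z hz => hb f z (by
      have h1 : ‖z - ζ‖ = R := by simpa [dist_eq_norm] using hz
      have h2 : ‖z‖ ≤ ‖z - ζ‖ + ‖ζ‖ := by simpa using norm_add_le (z - ζ) ζ
      linarith))
  refine h.trans (le_of_eq ?_)
  ring

theorem dense_ext {E F : Type} [NormedAddCommGroup E] [InnerProductSpace ℂ E]
    [NormedAddCommGroup F] [NormedSpace ℂ F] {ι : Type} (b : HilbertBasis ι ℂ E) {S T : E →L[ℂ] F}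
    (h : ∀ i, S (b i) = T (b i)) : S = T := by
  refine ContinuousLinearMap.ext_on (s := Set.range b) ?_ ?_
  · rw [Submodule.dense_iff_topologicalClosure_eq_top]
    exact b.dense_span
  · rintro _ ⟨i, rfl⟩
    exact h i

/-- The transvectant `C_{μ,ν,k} ∑_j (-1)^j (k choose j) / ((μ)_j (ν)_{k-j}) ∂_z^j ∂_w^{k-j} f(z) g(w)` at
`z = w = ζ`. -/
def transvectant (μ ν k : ℕ) (f g : ℂ → ℂ) (ζ : ℂ) : ℂ :=
  cst μ ν k * ∑ j ∈ Finset.range (k + 1),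
    (-1) ^ j * (k.choose j : ℂ) / (μ.ascFactorial j * ν.ascFactorial (k - j)) *
      (iteratedDeriv j f ζ * iteratedDeriv (k - j) g ζ)

theorem adjoint_emb_htmul (a b : ℕ) :
    (emb μ ν k).toContinuousLinearMap.adjoint (htmul (e μ a) (e ν b)) =
      if k ≤ a + b then (cf μ ν k (a + b - k) (a, b) : ℂ) • e (μ + ν + 2 * k) (a + b - k) else 0 := by
  apply (basis (μ + ν + 2 * k)).repr.injective
  ext n
  rw [HilbertBasis.repr_apply_apply, HilbertBasis.repr_apply_apply, basis_apply,
    ContinuousLinearMap.adjoint_inner_right, LinearIsometry.coe_toContinuousLinearMap, emb_e,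
    inner_vec_htmul n (a, b)]
  split_ifs with h1 h2 h2
  · have : a + b - k = n := by simp only at h1; omega
    rw [this, inner_smul_right, orthonormal_iff_ite.1 (orthonormal_e _), if_pos rfl, mul_one]
  · simp only at h1; omega
  · have : n ≠ a + b - k := by simp only at h1; omega
    rw [inner_smul_right, orthonormal_iff_ite.1 (orthonormal_e _), if_neg this, mul_zero]
  · simp

theorem transvectant_e (a b : ℕ) {ζ : ℂ} (hζ : ζ ∈ 𝔻) :
    transvectant μ ν k (e μ a) (e ν b) ζ =
      (emb μ ν k).toContinuousLinearMap.adjoint (htmul (e μ a) (e ν b)) ζ := by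
  have hd : ∀ (κ : ℕ) [Fact (1 < κ)] (n j : ℕ), iteratedDeriv j (e κ n) ζ =
      (Real.sqrt (wt κ n) : ℂ) * (n.descFactorial j * ζ ^ (n - j)) := by
    intro κ _ n j
    rw [e, coe_smul, iteratedDeriv_const_smul_field, iteratedDeriv_monomial κ n j hζ]
    rfl
  rw [adjoint_emb_htmul, transvectant]
  simp only [hd]
  split_ifs with h
  · have h1 : ∀ j ∈ Finset.range (k + 1),
        (-1) ^ j * (k.choose j : ℂ) / (μ.ascFactorial j * ν.ascFactorial (k - j)) *
        ((Real.sqrt (wt μ a) : ℂ) * (a.descFactorial j * ζ ^ (a - j)) *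
          ((Real.sqrt (wt ν b) : ℂ) * (b.descFactorial (k - j) * ζ ^ (b - (k - j))))) =
        ((tcoef μ ν k j * (a.descFactorial j * b.descFactorial (k - j)) : ℝ) : ℂ) *
          (Real.sqrt (wt μ a) * Real.sqrt (wt ν b) * ζ ^ (a + b - k)) := by
      intro j hj
      have hj' : j ≤ k := by have := Finset.mem_range.1 hj; omega
      rw [tcoef]
      push_cast
      by_cases ha : a < j
      · rw [Nat.descFactorial_eq_zero_iff_lt.2 ha]
        simp
      by_cases hb : b < k - j
      · rw [Nat.descFactorial_eq_zero_iff_lt.2 hb]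
        simp
      rw [show a + b - k = (a - j) + (b - (k - j)) by omega, pow_add]
      ring
    rw [Finset.sum_congr rfl h1, ← Finset.sum_mul, ← ofReal_sum]
    change _ = (cf μ ν k (a + b - k) (a, b) : ℂ) * (e (μ + ν + 2 * k) (a + b - k) ζ)
    have h2 : e (μ + ν + 2 * k) (a + b - k) ζ =
        (Real.sqrt (wt (μ + ν + 2 * k) (a + b - k)) : ℂ) * ζ ^ (a + b - k) := by
      rw [e, coe_smul, Pi.smul_apply, monomial_apply _ _ hζ, smul_eq_mul]
    rw [h2, cf, ← tau]
    have w3 := wt_pos (μ + ν + 2 * k) (a + b - k)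
    have h3 : Real.sqrt (wt μ a * wt ν b / wt (μ + ν + 2 * k) (a + b - k)) *
        Real.sqrt (wt (μ + ν + 2 * k) (a + b - k)) = Real.sqrt (wt μ a) * Real.sqrt (wt ν b) := by
      have w1 := wt_pos μ a
      have w2 := wt_pos ν b
      rw [← Real.sqrt_mul (by positivity), div_mul_cancel₀ _ w3.ne', Real.sqrt_mul w1.le]
    have h4 := congrArg (fun x : ℝ => (x : ℂ)) h3
    simp only [ofReal_mul] at h4
    simp only [ofReal_mul]
    linear_combination -(cst μ ν k * tau μ ν k a b * ζ ^ (a + b - k) : ℂ) * h4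
  · rw [Finset.sum_eq_zero, mul_zero]
    · rfl
    · intro j hj
      have hj' : j ≤ k := by have := Finset.mem_range.1 hj; omega
      by_cases ha : a < j
      · rw [Nat.descFactorial_eq_zero_iff_lt.2 ha]
        simp
      · rw [Nat.descFactorial_eq_zero_iff_lt.2 (show b < k - j by omega)]
        simp

theorem adjoint_emb_apply (f : Bergman μ) (g : Bergman ν) {ζ : ℂ} (hζ : ζ ∈ 𝔻) :
    (emb μ ν k).toContinuousLinearMap.adjoint (htmul f g) ζ = transvectant μ ν k f g ζ := by
  obtain ⟨ev, hev⟩ := exists_derivFunctional (μ + ν + 2 * k) 0 hζ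
  choose D hD using fun j => exists_derivFunctional μ j hζ
  choose D' hD' using fun j => exists_derivFunctional ν j hζ
  let B₁ : Bergman μ →L[ℂ] Bergman ν →L[ℂ] ℂ :=
    (ContinuousLinearMap.compL ℂ (Bergman ν) (Bergman μ ⊗[ℂ] Bergman ν) ℂ
      (ev.comp ((emb μ ν k).toContinuousLinearMap.adjoint.comp
        (UniformSpace.Completion.toComplL (𝕜 := ℂ))))).comp
      (TensorProduct.mkL ℂ (Bergman μ) (Bergman ν))
  have hB₁ : ∀ f g, B₁ f g = (emb μ ν k).toContinuousLinearMap.adjoint (htmul f g) ζ := by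
    intro f g
    have := hev ((emb μ ν k).toContinuousLinearMap.adjoint (htmul f g))
    rw [iteratedDeriv_zero] at this
    exact this
  let B₂ : Bergman μ →L[ℂ] Bergman ν →L[ℂ] ℂ :=
    (cst μ ν k : ℂ) • ∑ j ∈ Finset.range (k + 1),
      ((-1) ^ j * (k.choose j : ℂ) / (μ.ascFactorial j * ν.ascFactorial (k - j))) •
        (D j).smulRight (D' (k - j))
  have hB₂ : ∀ f g, B₂ f g = transvectant μ ν k f g ζ := by
    intro f g
    simp only [B₂, transvectant, _root_.smul_apply, _root_.sum_apply,
      ContinuousLinearMap.smulRight_apply, smul_eq_mul, hD, hD']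
  clear_value B₁ B₂
  have hB : B₁ = B₂ := by
    refine dense_ext (basis μ) fun a => dense_ext (basis ν) fun b => ?_
    rw [hB₁, hB₂, basis_apply, basis_apply, transvectant_e a b hζ]
  rw [← hB₁, ← hB₂, hB]

theorem exists_proj (μ ν k : ℕ) [Fact (1 < μ)] [Fact (1 < ν)] :
    ∃ P : HTensor (Bergman μ) (Bergman ν) →L[ℂ] Bergman (μ + ν + 2 * k),
      (∀ (f : Bergman μ) (g : Bergman ν), ∀ ζ ∈ 𝔻, P (htmul f g) ζ = transvectant μ ν k f g ζ) ∧
        P ∘L P.adjoint = ContinuousLinearMap.id ℂ _ := by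
  refine ⟨(emb μ ν k).toContinuousLinearMap.adjoint,
    fun f g ζ hζ => adjoint_emb_apply f g hζ, ?_⟩
  rw [ContinuousLinearMap.adjoint_adjoint]
  exact LinearIsometry.adjoint_comp_self _

end Projection

/-- The projection `P_k` of `𝓗_μ ⊗ 𝓗_ν` onto its component `𝓗_{μ+ν+2k}`: the bounded operator with
`P_k (f ⊗ g)(ζ) = C_{μ,ν,k} ∑_j (-1)^j (k choose j) / ((μ)_j (ν)_{k-j}) f^{(j)}(ζ) g^{(k-j)}(ζ)`. The
elementary tensors span a dense subspace, so this formula determines `P_k`. -/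
def proj (μ ν k : ℕ) [Fact (1 < μ)] [Fact (1 < ν)] :
    HTensor (Bergman μ) (Bergman ν) →L[ℂ] Bergman (μ + ν + 2 * k) :=
  (exists_proj μ ν k).choose

theorem proj_htmul (μ ν k : ℕ) [Fact (1 < μ)] [Fact (1 < ν)] (f : Bergman μ) (g : Bergman ν) (ζ : ℂ)
    (hζ : ζ ∈ 𝔻) : proj μ ν k (htmul f g) ζ = transvectant μ ν k f g ζ :=
  (exists_proj μ ν k).choose_spec.1 f g ζ hζ

theorem proj_comp_adjoint (μ ν k : ℕ) [Fact (1 < μ)] [Fact (1 < ν)] :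
    proj μ ν k ∘L (proj μ ν k).adjoint = ContinuousLinearMap.id ℂ _ :=
  (exists_proj μ ν k).choose_spec.2

/-- The quantum channel `A ↦ P_k (A ⊗ I_ν) P_k^*` from `B(𝓗_μ)` to `B(𝓗_{μ+ν+2k})`. -/
def channel (μ ν k : ℕ) [Fact (1 < μ)] [Fact (1 < ν)] :
    (Bergman μ →L[ℂ] Bergman μ) →ₗ[ℂ]
      (Bergman (μ + ν + 2 * k) →L[ℂ] Bergman (μ + ν + 2 * k)) where
  toFun A := proj μ ν k ∘L tensorId (Bergman ν) A ∘L (proj μ ν k).adjoint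
  map_add' A B := by
    rw [tensorId_add, ContinuousLinearMap.add_comp, ContinuousLinearMap.comp_add]
  map_smul' c A := by
    rw [tensorId_smul, ContinuousLinearMap.smul_comp, ContinuousLinearMap.comp_smul,
      RingHom.id_apply]

/-- A bounded operator `A` on a Hilbert space is of trace class if `∑ ⟨e_i, |A| e_i⟩ < ∞` for
orthonormal bases `(e_i)`, where `|A| = (A^* A)^{1/2}`. Each orthonormal basis can be indexed by a set
of vectors of the space. -/
def IsTraceClass {H : Type} [NormedAddCommGroup H] [InnerProductSpace ℂ H] [CompleteSpace H]
    (A : H →L[ℂ] H) : Prop :=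
  ∀ (s : Set H) (b : HilbertBasis s ℂ H), Summable fun i => ⟪b i, CFC.abs A (b i)⟫_ℂ

/-- `Tr A = t`: the sum `∑ ⟨e_i, A e_i⟩` converges (unconditionally) to `t` for all orthonormal
bases `(e_i)`. Since orthonormal bases exist, `t` is unique. -/
def HasTrace {H : Type} [NormedAddCommGroup H] [InnerProductSpace ℂ H] [CompleteSpace H]
    (A : H →L[ℂ] H) (t : ℂ) : Prop :=
  ∀ (s : Set H) (b : HilbertBasis s ℂ H), HasSum (fun i => ⟪b i, A (b i)⟫_ℂ) t

/-- Complete positivity: `Φ` applied entrywise maps positive matrices over the first algebra to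
positive matrices over the second, for matrices of each size. -/
def IsCompletelyPositive {H K : Type} [NormedAddCommGroup H] [InnerProductSpace ℂ H]
    [CompleteSpace H] [NormedAddCommGroup K] [InnerProductSpace ℂ K] [CompleteSpace K]
    (Φ : (H →L[ℂ] H) →ₗ[ℂ] (K →L[ℂ] K)) : Prop :=
  ∃ Ψ : CompletelyPositiveMap (H →L[ℂ] H) (K →L[ℂ] K), Ψ.toLinearMap = Φ

end SU11

end

/-!
Write `P = P_k` and `r = (μ + ν + 2k - 1) / (μ - 1)`. The channel is a compression
`A ↦ P (A ⊗ I) P†`, hence completely positive, and on a product it factors as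
`P (B† C ⊗ I) P† = ((B ⊗ I) P†)† (C ⊗ I) P†`. If the partial trace of `P† P` over `𝓗_ν` is `r • I`,
then `B ↦ (B ⊗ I) P†` preserves the Hilbert–Schmidt class and scales its inner product by `r`;
since a trace class operator is a product `B† C` of Hilbert–Schmidt operators, the channel
preserves the trace class and multiplies the trace by `r`.

In the monomial bases `P (e_a ⊗ e_b)` is a multiple of `e_{a+b-k}`, so the partial trace is diagonal
with entries `∑ b, ‖P (e_a ⊗ e_b)‖²`. The raising and lowering identities of the discrete series
make the difference of the entries for `a + 1` and `a` telescope to zero, and the entry for `a = 0`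
is Gauss's value of a `₂F₁` at `1`.
-/

noncomputable section

namespace SU11

open scoped InnerProductSpace TensorProduct

section HilbertSchmidt

variable {𝕜 E F G ι κ : Type*} [RCLike 𝕜]
  [NormedAddCommGroup E] [InnerProductSpace 𝕜 E]
  [NormedAddCommGroup F] [InnerProductSpace 𝕜 F]
  [NormedAddCommGroup G] [InnerProductSpace 𝕜 G]

theorem hasSum_norm_apply_sq_of_pairwise_orthogonal (b : HilbertBasis ι 𝕜 E) (T : E →L[𝕜] F)
    (hT : Pairwise fun i j => ⟪T (b i), T (b j)⟫_𝕜 = 0) (x : E) :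
    HasSum (fun i => ‖⟪b i, x⟫_𝕜‖ ^ 2 * ‖T (b i)‖ ^ 2) (‖T x‖ ^ 2) := by
  have expand : HasSum (fun i => ⟪b i, x⟫_𝕜 • T (b i)) (T x) := by
    simpa only [b.repr_apply_apply, map_smul] using (b.hasSum_repr x).mapL T
  have coeff (i : ι) : ⟪T (b i), T x⟫_𝕜 = ⟪b i, x⟫_𝕜 * ((‖T (b i)‖ ^ 2 : ℝ) : 𝕜) := by
    have single : HasSum (fun j => ⟪T (b i), ⟪b j, x⟫_𝕜 • T (b j)⟫_𝕜)
        ⟪T (b i), ⟪b i, x⟫_𝕜 • T (b i)⟫_𝕜 :=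
      hasSum_single i fun j hj => by rw [inner_smul_right, hT hj.symm, mul_zero]
    rw [← innerSL_apply_apply 𝕜, (expand.mapL (innerSL 𝕜 (T (b i)))).unique single,
      inner_smul_right, inner_self_eq_norm_sq_to_K, RCLike.ofReal_pow]
  rw [← RCLike.hasSum_ofReal 𝕜, RCLike.ofReal_pow, ← inner_self_eq_norm_sq_to_K]
  refine (expand.mapL (innerSL 𝕜 (T x))).congr_fun fun i => ?_
  rw [innerSL_apply_apply, inner_smul_right, ← inner_conj_symm (T x), coeff, map_mul,
    RCLike.conj_ofReal, ← mul_assoc, RCLike.mul_conj]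
  push_cast
  rfl

theorem hasSum_norm_inner_sq (b : HilbertBasis ι 𝕜 E) (x : E) :
    HasSum (fun i => ‖⟪b i, x⟫_𝕜‖ ^ 2) (‖x‖ ^ 2) := by
  have h := hasSum_norm_apply_sq_of_pairwise_orthogonal b (ContinuousLinearMap.id 𝕜 E)
    b.orthonormal.2 x
  simpa only [ContinuousLinearMap.id_apply, b.orthonormal.1, one_pow, mul_one] using h

theorem summable_norm_inner_sq_iff (c : HilbertBasis κ 𝕜 F) (v : ι → F) :
    (Summable fun p : ι × κ => ‖⟪c p.2, v p.1⟫_𝕜‖ ^ 2) ↔ Summable fun i => ‖v i‖ ^ 2 := by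
  rw [summable_prod_of_nonneg fun p => sq_nonneg _]
  simp only [fun i => (hasSum_norm_inner_sq c (v i)).tsum_eq]
  exact and_iff_right fun i => (hasSum_norm_inner_sq c (v i)).summable

/-- Hilbert–Schmidt operators between Hilbert spaces. As for `IsTraceClass`, the orthonormal bases
are indexed by sets of vectors. -/
def IsHilbertSchmidt (S : E →L[𝕜] F) : Prop :=
  ∀ (s : Set E) (b : HilbertBasis s 𝕜 E), Summable fun i => ‖S (b i)‖ ^ 2

theorem IsHilbertSchmidt.comp_left {S : E →L[𝕜] F} (hS : IsHilbertSchmidt S) (T : F →L[𝕜] G) :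
    IsHilbertSchmidt (T ∘L S) := fun s b => by
  refine .of_nonneg_of_le (fun i => sq_nonneg _) (fun i => ?_) ((hS s b).mul_left (‖T‖ ^ 2))
  rw [← mul_pow]
  gcongr
  exact T.le_opNorm _

variable [CompleteSpace E] [CompleteSpace F] [CompleteSpace G]

theorem summable_norm_sq_iff_adjoint (b : HilbertBasis ι 𝕜 E) (c : HilbertBasis κ 𝕜 F)
    (S : E →L[𝕜] F) :
    (Summable fun i => ‖S (b i)‖ ^ 2) ↔ Summable fun j => ‖S.adjoint (c j)‖ ^ 2 := by
  rw [← summable_norm_inner_sq_iff c, ← summable_norm_inner_sq_iff b,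
    ← (Equiv.prodComm κ ι).summable_iff]
  refine summable_congr fun p => ?_
  rw [ContinuousLinearMap.adjoint_inner_right, norm_inner_symm]
  rfl

theorem isHilbertSchmidt_iff_summable (b : HilbertBasis ι 𝕜 E) {S : E →L[𝕜] F} :
    IsHilbertSchmidt S ↔ Summable fun i => ‖S (b i)‖ ^ 2 := by
  obtain ⟨t, c, -⟩ := exists_hilbertBasis 𝕜 F
  obtain ⟨s, b₀, -⟩ := exists_hilbertBasis 𝕜 E
  simp only [IsHilbertSchmidt, summable_norm_sq_iff_adjoint _ c]
  exact ⟨fun h => h s b₀, fun h _ _ => h⟩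

namespace IsHilbertSchmidt

theorem adjoint {S : E →L[𝕜] F} (hS : IsHilbertSchmidt S) : IsHilbertSchmidt S.adjoint := by
  obtain ⟨s, b, -⟩ := exists_hilbertBasis 𝕜 E
  exact fun t c => (summable_norm_sq_iff_adjoint b c S).1 (hS s b)

theorem comp_right {S : F →L[𝕜] G} (hS : IsHilbertSchmidt S) (T : E →L[𝕜] F) :
    IsHilbertSchmidt (S ∘L T) := by
  simpa only [ContinuousLinearMap.adjoint_comp, ContinuousLinearMap.adjoint_adjoint] using
    (hS.adjoint.comp_left T.adjoint).adjoint

theorem summable_inner_mul_inner {B C : E →L[𝕜] F} (hB : IsHilbertSchmidt B)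
    (hC : IsHilbertSchmidt C) (b : HilbertBasis ι 𝕜 E) (c : HilbertBasis κ 𝕜 F) :
    Summable fun p : ι × κ => ⟪B (b p.1), c p.2⟫_𝕜 * ⟪c p.2, C (b p.1)⟫_𝕜 := by
  have summable_sq {S : E →L[𝕜] F} (hS : IsHilbertSchmidt S) :
      Summable fun p : ι × κ => ‖⟪c p.2, S (b p.1)⟫_𝕜‖ ^ 2 :=
    (summable_norm_inner_sq_iff c fun i => S (b i)).2 ((isHilbertSchmidt_iff_summable b).1 hS)
  refine .of_norm_bounded ((summable_sq hB).add (summable_sq hC)) fun p => ?_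
  rw [norm_mul, norm_inner_symm]
  nlinarith only [two_mul_le_add_sq ‖⟪c p.2, B (b p.1)⟫_𝕜‖ ‖⟪c p.2, C (b p.1)⟫_𝕜‖,
    norm_nonneg ⟪c p.2, B (b p.1)⟫_𝕜, norm_nonneg ⟪c p.2, C (b p.1)⟫_𝕜]

theorem exists_hasSum_inner {B C : E →L[𝕜] F} (hB : IsHilbertSchmidt B)
    (hC : IsHilbertSchmidt C) (b : HilbertBasis ι 𝕜 E) (c : HilbertBasis κ 𝕜 F) :
    ∃ t : 𝕜, HasSum (fun i => ⟪B (b i), C (b i)⟫_𝕜) t ∧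
      HasSum (fun j => ⟪C.adjoint (c j), B.adjoint (c j)⟫_𝕜) t := by
  obtain ⟨t, ht⟩ := hB.summable_inner_mul_inner hC b c
  refine ⟨t, ht.prod_fiberwise fun i => c.hasSum_inner_mul_inner (B (b i)) (C (b i)),
    ((Equiv.prodComm κ ι).hasSum_iff.2 ht).prod_fiberwise fun j => ?_⟩
  refine (b.hasSum_inner_mul_inner (C.adjoint (c j)) (B.adjoint (c j))).congr_fun fun i => ?_
  rw [ContinuousLinearMap.adjoint_inner_left, ContinuousLinearMap.adjoint_inner_right, mul_comm]
  rfl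

end IsHilbertSchmidt

end HilbertSchmidt

section TraceClass

theorem exists_eq_comp_of_norm_apply_le {𝕜 E F G : Type*} [RCLike 𝕜] [NormedAddCommGroup E]
    [NormedSpace 𝕜 E] [NormedAddCommGroup F] [NormedSpace 𝕜 F] [CompleteSpace F]
    [NormedAddCommGroup G] [InnerProductSpace 𝕜 G] [CompleteSpace G] {S : E →L[𝕜] F}
    {T : E →L[𝕜] G} {M : ℝ} (h : ∀ x, ‖S x‖ ≤ M * ‖T x‖) : ∃ W : G →L[𝕜] F, S = W ∘L T := by
  set R := T.range.topologicalClosure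
  have : CompleteSpace R := T.range.isClosed_topologicalClosure.completeSpace_coe
  let T' : E →ₗ[𝕜] R := T.toLinearMap.codRestrict R fun x =>
    T.range.le_topologicalClosure (LinearMap.mem_range_self _ x)
  have dense : DenseRange T' := by
    intro y
    rw [closure_subtype]
    refine closure_mono ?_ (y.2 : (y : G) ∈ closure (T.range : Set G))
    rintro _ ⟨x, rfl⟩
    exact ⟨T' x, ⟨x, rfl⟩, rfl⟩
  refine ⟨S.toLinearMap.extendOfNorm T' ∘L R.orthogonalProjectionOnto, ?_⟩
  ext x
  have proj_T : R.orthogonalProjectionOnto (T x) = T' x :=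
    Submodule.orthogonalProjectionOnto_mem_subspace_eq_self (T' x)
  rw [ContinuousLinearMap.comp_apply, ContinuousLinearMap.comp_apply, proj_T,
    LinearMap.extendOfNorm_eq dense ⟨M, h⟩]
  rfl

variable {E F κ : Type*} [NormedAddCommGroup E] [InnerProductSpace ℂ E] [CompleteSpace E]
  [NormedAddCommGroup F] [InnerProductSpace ℂ F] [CompleteSpace F]
  {H : Type} [NormedAddCommGroup H] [InnerProductSpace ℂ H] [CompleteSpace H]

theorem norm_abs_apply (A : E →L[ℂ] E) (x : E) : ‖CFC.abs A x‖ = ‖A x‖ := by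
  have h : (CFC.abs A).adjoint ∘L CFC.abs A = A.adjoint ∘L A := by
    rw [(CFC.abs_nonneg A).isSelfAdjoint.adjoint_eq]
    exact CFC.abs_mul_abs A
  rw [← sq_eq_sq₀ (norm_nonneg _) (norm_nonneg _),
    ContinuousLinearMap.apply_norm_sq_eq_inner_adjoint_left, h,
    ← ContinuousLinearMap.apply_norm_sq_eq_inner_adjoint_left]

theorem norm_sqrt_apply_sq {A : E →L[ℂ] E} (hA : 0 ≤ A) (x : E) :
    ‖CFC.sqrt A x‖ ^ 2 = (⟪x, A x⟫_ℂ).re := by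
  rw [ContinuousLinearMap.apply_norm_sq_eq_inner_adjoint_right,
    (CFC.sqrt_nonneg A).isSelfAdjoint.adjoint_eq]
  exact congrArg (fun B : E →L[ℂ] E => (⟪x, B x⟫_ℂ).re) (CFC.sqrt_mul_sqrt_self A hA)

theorem IsTraceClass.isHilbertSchmidt_sqrt_abs {A : H →L[ℂ] H} (hA : IsTraceClass A) :
    IsHilbertSchmidt (CFC.sqrt (CFC.abs A)) := fun s b => by
  simpa only [norm_sqrt_apply_sq (CFC.abs_nonneg A), Complex.reCLM_apply] using
    (hA s b).mapL Complex.reCLM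

theorem IsTraceClass.exists_eq_adjoint_comp {A : H →L[ℂ] H} (hA : IsTraceClass A) :
    ∃ B C : H →L[ℂ] H, IsHilbertSchmidt B ∧ IsHilbertSchmidt C ∧ A = B.adjoint ∘L C := by
  obtain ⟨U, polar⟩ : ∃ U : H →L[ℂ] H, A = U ∘L CFC.abs A :=
    exists_eq_comp_of_norm_apply_le (M := 1) fun x => by rw [one_mul, norm_abs_apply]
  set R := CFC.sqrt (CFC.abs A)
  have hR : IsHilbertSchmidt R := hA.isHilbertSchmidt_sqrt_abs
  have R_sq : R ∘L R = CFC.abs A := CFC.sqrt_mul_sqrt_self _ (CFC.abs_nonneg A)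
  refine ⟨(U ∘L R).adjoint, R, (hR.comp_left U).adjoint, hR, ?_⟩
  rw [ContinuousLinearMap.adjoint_adjoint, ContinuousLinearMap.comp_assoc, R_sq, ← polar]

namespace IsHilbertSchmidt

variable {B C : H →L[ℂ] F}

theorem isTraceClass_adjoint_comp (hB : IsHilbertSchmidt B) (hC : IsHilbertSchmidt C) :
    IsTraceClass (B.adjoint ∘L C) := by
  intro s b
  obtain ⟨V, polar⟩ : ∃ V : H →L[ℂ] H, CFC.abs (B.adjoint ∘L C) = V ∘L (B.adjoint ∘L C) :=
    exists_eq_comp_of_norm_apply_le (M := 1) fun x => by rw [one_mul, norm_abs_apply]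
  obtain ⟨_, c, -⟩ := exists_hilbertBasis ℂ F
  obtain ⟨t, ht, -⟩ := (hB.comp_right V.adjoint).exists_hasSum_inner hC b c
  refine ht.summable.congr fun i => ?_
  rw [polar, ContinuousLinearMap.comp_apply, ContinuousLinearMap.comp_apply,
    ContinuousLinearMap.comp_apply, ← ContinuousLinearMap.adjoint_inner_right,
    ← ContinuousLinearMap.adjoint_inner_left V]

theorem hasTrace_adjoint_comp_iff (hB : IsHilbertSchmidt B) (hC : IsHilbertSchmidt C)
    (c : HilbertBasis κ ℂ F) {t : ℂ} :
    HasTrace (B.adjoint ∘L C) t ↔ HasSum (fun j => ⟪C.adjoint (c j), B.adjoint (c j)⟫_ℂ) t := by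
  have inner_eq (x : H) : ⟪x, (B.adjoint ∘L C) x⟫_ℂ = ⟪B x, C x⟫_ℂ := B.adjoint_inner_right x (C x)
  simp only [HasTrace, inner_eq]
  constructor
  · intro ht
    obtain ⟨s, b, -⟩ := exists_hilbertBasis ℂ H
    obtain ⟨t', hB', hC'⟩ := hB.exists_hasSum_inner hC b c
    rwa [(ht s b).unique hB']
  · intro ht s b
    obtain ⟨t', hB', hC'⟩ := hB.exists_hasSum_inner hC b c
    rwa [ht.unique hC']

end IsHilbertSchmidt

theorem IsTraceClass.exists_hasTrace {A : H →L[ℂ] H} (hA : IsTraceClass A) :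
    ∃ t : ℂ, HasTrace A t := by
  obtain ⟨B, C, hB, hC, rfl⟩ := hA.exists_eq_adjoint_comp
  obtain ⟨_, c, -⟩ := exists_hilbertBasis ℂ H
  obtain ⟨t, -, ht⟩ := hB.exists_hasSum_inner hC c c
  exact ⟨t, (hB.hasTrace_adjoint_comp_iff hC c).2 ht⟩

end TraceClass

section CompletePositivity

variable {𝒜 : Type*} [NonUnitalCStarAlgebra 𝒜] [PartialOrder 𝒜] [StarOrderedRing 𝒜]

theorem nonneg_of_conjugate_eq_neg_imp_eq_zero {a : 𝒜} (ha : IsSelfAdjoint a)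
    (h : ∀ q y : 𝒜, star q * a * q = -(star y * y) → y = 0) : 0 ≤ a := by
  rw [← CFC.negPart_eq_zero_iff a]
  have nonneg : 0 ≤ a⁻ := CFC.negPart_nonneg a
  have star_eq : star a⁻ = a⁻ := nonneg.isSelfAdjoint.star_eq
  have conjugate : star a⁻ * a * a⁻ = -(a⁻ * a⁻ * a⁻) := by
    nth_rw 2 [← CFC.posPart_sub_negPart a]
    rw [star_eq, mul_sub, CFC.negPart_mul_posPart, zero_sub, neg_mul]
  have cube_eq : star (CFC.sqrt a⁻ * a⁻) * (CFC.sqrt a⁻ * a⁻) = a⁻ * a⁻ * a⁻ := by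
    rw [star_mul, star_eq, (CFC.sqrt_nonneg a⁻).isSelfAdjoint.star_eq, mul_assoc,
      ← mul_assoc (CFC.sqrt a⁻), CFC.sqrt_mul_sqrt_self _ nonneg, mul_assoc]
  have cube : a⁻ * a⁻ * a⁻ = 0 := by
    rw [← cube_eq, h a⁻ (CFC.sqrt a⁻ * a⁻) (by rw [conjugate, cube_eq]), mul_zero]
  rw [← CStarRing.star_mul_self_eq_zero_iff a⁻, star_eq,
    ← CStarRing.star_mul_self_eq_zero_iff (a⁻ * a⁻), star_mul, star_eq, ← mul_assoc, cube, zero_mul]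

theorem exists_eq_star_mul_self_of_nonneg {a : 𝒜} (ha : 0 ≤ a) : ∃ b, a = star b * b :=
  CStarAlgebra.nonneg_iff_eq_star_mul_self.1 ha

theorem eq_zero_of_sum_star_mul_self_nonpos {m : Type*} [Fintype m] {x : m → 𝒜}
    (h : ∑ l, star (x l) * x l ≤ 0) (l : m) : x l = 0 := by
  have nonneg (l : m) : 0 ≤ star (x l) * x l := star_mul_self_nonneg (x l)
  have sum_eq := h.antisymm (Finset.sum_nonneg fun l _ => nonneg l)
  exact (CStarRing.star_mul_self_eq_zero_iff (x l)).1 <|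
    (Finset.sum_eq_zero_iff_of_nonneg fun l _ => nonneg l).1 sum_eq l (Finset.mem_univ l)

theorem cstarMatrix_nonneg_of_quadratic_nonneg {n : Type*} [Fintype n] {M : CStarMatrix n n 𝒜}
    (hM : IsSelfAdjoint M) (h : ∀ q : n → 𝒜, 0 ≤ ∑ i, ∑ j, star (q i) * M i j * q j) : 0 ≤ M := by
  refine nonneg_of_conjugate_eq_neg_imp_eq_zero hM fun Q Y hQY => ?_
  have diagonal (j : n) : ∑ l, star (Y l j) * Y l j ≤ 0 := by
    have hj := h fun i => Q i j
    rw [Finset.sum_comm] at hj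
    have hQYj : (star Q * M * Q) j j = -(star Y * Y) j j := by rw [hQY]; rfl
    simp only [CStarMatrix.mul_apply, CStarMatrix.star_apply, Finset.sum_mul] at hQYj
    rwa [hQYj, Left.nonneg_neg_iff] at hj
  ext1 l j
  exact eq_zero_of_sum_star_mul_self_nonpos (diagonal j) l

variable {H K L : Type*} [NormedAddCommGroup H] [InnerProductSpace ℂ H] [CompleteSpace H]
  [NormedAddCommGroup K] [InnerProductSpace ℂ K] [CompleteSpace K]
  [NormedAddCommGroup L] [InnerProductSpace ℂ L] [CompleteSpace L]

theorem cstarMatrix_nonneg_of_eq_sum_adjoint_comp {m n : Type*} [Fintype m] [Fintype n]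
    {M : CStarMatrix n n (H →L[ℂ] H)} (X : m → n → H →L[ℂ] K)
    (hM : ∀ i j, M i j = ∑ l, (X l i).adjoint ∘L X l j) : 0 ≤ M := by
  refine cstarMatrix_nonneg_of_quadratic_nonneg ?_ fun q => ?_
  · ext1 i j
    rw [CStarMatrix.star_apply, hM, hM, star_sum]
    refine Finset.sum_congr rfl fun l _ => ?_
    rw [ContinuousLinearMap.star_eq_adjoint, ContinuousLinearMap.adjoint_comp,
      ContinuousLinearMap.adjoint_adjoint]
  · have gram : ∑ i, ∑ j, star (q i) * M i j * q j =
        ∑ l, (∑ i, X l i ∘L q i).adjoint ∘L (∑ j, X l j ∘L q j) := by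
      ext x
      simp only [hM, ContinuousLinearMap.star_eq_adjoint, ContinuousLinearMap.comp_apply,
        mul_apply_eq_comp, ContinuousLinearMap.adjoint_comp, map_sum,
        Finset.mul_sum, Finset.sum_mul, _root_.sum_apply]
      rw [Finset.sum_comm, Finset.sum_comm_cycle]
    rw [gram]
    refine Finset.sum_nonneg fun l _ => ?_
    rw [ContinuousLinearMap.nonneg_iff_isPositive]
    exact ContinuousLinearMap.isPositive_adjoint_comp_self _

theorem isCompletelyPositive_of_apply_adjoint_comp {H K : Type} [NormedAddCommGroup H]
    [InnerProductSpace ℂ H] [CompleteSpace H] [NormedAddCommGroup K] [InnerProductSpace ℂ K]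
    [CompleteSpace K] {Φ : (H →L[ℂ] H) →ₗ[ℂ] (K →L[ℂ] K)} (X : (H →L[ℂ] H) → K →L[ℂ] L)
    (hΦ : ∀ A B, Φ (A.adjoint ∘L B) = (X A).adjoint ∘L X B) : IsCompletelyPositive Φ := by
  refine ⟨⟨Φ, fun n M hM => ?_⟩, rfl⟩
  obtain ⟨N, rfl⟩ := exists_eq_star_mul_self_of_nonneg hM
  refine cstarMatrix_nonneg_of_eq_sum_adjoint_comp (fun l i => X (N l i)) fun i j => ?_
  rw [CStarMatrix.map_apply, CStarMatrix.mul_apply]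
  change Φ _ = _
  rw [map_sum]
  exact Finset.sum_congr rfl fun l _ => hΦ _ _

end CompletePositivity

section Tensor

variable {E F G ι κ : Type} [NormedAddCommGroup E] [InnerProductSpace ℂ E]
  [NormedAddCommGroup F] [InnerProductSpace ℂ F] [NormedAddCommGroup G] [NormedSpace ℂ G]

variable (E) in
/-- The bounded operator `x ↦ x ⊗ y` into the Hilbert space tensor product. -/
def htmulRight (y : F) : E →L[ℂ] HTensor E F :=
  UniformSpace.Completion.toComplL (𝕜 := ℂ) ∘L (TensorProduct.mkL ℂ E F).flip y

variable (F) in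
/-- The bounded operator `y ↦ x ⊗ y` into the Hilbert space tensor product. -/
def htmulLeft (x : E) : F →L[ℂ] HTensor E F :=
  UniformSpace.Completion.toComplL (𝕜 := ℂ) ∘L TensorProduct.mkL ℂ E F x

theorem htensor_ext {S T : HTensor E F →L[ℂ] G} (h : ∀ x y, S (htmul x y) = T (htmul x y)) :
    S = T := by
  ext v
  induction v using UniformSpace.Completion.induction_on with
  | hp => exact isClosed_eq S.continuous T.continuous
  | ih v =>
    have eq_on_tensor :
        S.toLinearMap ∘ₗ (UniformSpace.Completion.toComplL (𝕜 := ℂ)).toLinearMap =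
          T.toLinearMap ∘ₗ (UniformSpace.Completion.toComplL (𝕜 := ℂ)).toLinearMap :=
      TensorProduct.ext' h
    exact LinearMap.congr_fun eq_on_tensor v

theorem htensor_ext_basis (b : HilbertBasis ι ℂ E) (c : HilbertBasis κ ℂ F)
    {S T : HTensor E F →L[ℂ] G} (h : ∀ i j, S (htmul (b i) (c j)) = T (htmul (b i) (c j))) :
    S = T := by
  refine htensor_ext fun x y => ?_
  have eq_left (i : ι) : S ∘L htmulLeft F (b i) = T ∘L htmulLeft F (b i) := dense_ext c (h i)
  have eq_right : S ∘L htmulRight E y = T ∘L htmulRight E y :=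
    dense_ext b fun i => DFunLike.congr_fun (eq_left i) y
  exact DFunLike.congr_fun eq_right x

theorem inner_htmul (x x' : E) (y y' : F) :
    ⟪htmul x y, htmul x' y'⟫_ℂ = ⟪x, x'⟫_ℂ * ⟪y, y'⟫_ℂ := by
  simp only [htmul, UniformSpace.Completion.inner_coe, TensorProduct.inner_tmul]

theorem tensorId_comp (A B : E →L[ℂ] E) : tensorId F (A ∘L B) = tensorId F A ∘L tensorId F B :=
  htensor_ext fun x y => by simp only [tensorId_htmul, ContinuousLinearMap.comp_apply]

theorem tensorId_adjoint [CompleteSpace E] (A : E →L[ℂ] E) :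
    tensorId F A.adjoint = (tensorId F A).adjoint := by
  refine htensor_ext fun x y => ext_inner_right ℂ fun v => ?_
  refine DFunLike.congr_fun (F := HTensor E F →L[ℂ] ℂ) (f := innerSL ℂ _) (g := innerSL ℂ _)
    (htensor_ext fun x' y' => ?_) v
  rw [innerSL_apply_apply, innerSL_apply_apply, ContinuousLinearMap.adjoint_inner_left,
    tensorId_htmul, tensorId_htmul, inner_htmul, inner_htmul,
    ContinuousLinearMap.adjoint_inner_left]

theorem orthonormal_htmul_of_orthonormal {u : ι → E} {v : κ → F} (hu : Orthonormal ℂ u)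
    (hv : Orthonormal ℂ v) : Orthonormal ℂ fun p : ι × κ => htmul (u p.1) (v p.2) := by
  classical
  rw [orthonormal_iff_ite]
  rintro ⟨i, j⟩ ⟨i', j'⟩
  rw [inner_htmul, orthonormal_iff_ite.1 hu, orthonormal_iff_ite.1 hv, ite_zero_mul_ite_zero,
    mul_one]
  simp only [Prod.mk.injEq]

/-- The Hilbert basis `b i ⊗ c j` of the Hilbert space tensor product. -/
def tensorBasis (b : HilbertBasis ι ℂ E) (c : HilbertBasis κ ℂ F) :
    HilbertBasis (ι × κ) ℂ (HTensor E F) :=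
  .mkOfOrthogonalEqBot (orthonormal_htmul_of_orthonormal b.orthonormal c.orthonormal) <| by
    refine (Submodule.eq_bot_iff _).2 fun v hv => ?_
    have inner_eq_zero : innerSL ℂ v = 0 := htensor_ext_basis b c fun i j => by
      rw [innerSL_apply_apply, _root_.zero_apply, inner_eq_zero_symm]
      exact hv _ (Submodule.subset_span ⟨(i, j), rfl⟩)
    exact inner_self_eq_zero.1 (DFunLike.congr_fun inner_eq_zero v)

theorem tensorBasis_apply (b : HilbertBasis ι ℂ E) (c : HilbertBasis κ ℂ F) (p : ι × κ) :
    tensorBasis b c p = htmul (b p.1) (c p.2) :=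
  congrFun (HilbertBasis.coe_mkOfOrthogonalEqBot _ _) p

end Tensor

section Compression

variable {E F G ι κ : Type} [NormedAddCommGroup E] [InnerProductSpace ℂ E] [CompleteSpace E]
  [NormedAddCommGroup F] [InnerProductSpace ℂ F]
  [NormedAddCommGroup G] [InnerProductSpace ℂ G] [CompleteSpace G]
  (P : HTensor E F →L[ℂ] G)

/-- The map `A ↦ P (A ⊗ I) P†`, in Stinespring form. -/
def compression : (E →L[ℂ] E) →ₗ[ℂ] G →L[ℂ] G where
  toFun A := P ∘L tensorId F A ∘L P.adjoint
  map_add' A B := by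
    rw [tensorId_add, ContinuousLinearMap.add_comp, ContinuousLinearMap.comp_add]
  map_smul' c A := by
    rw [tensorId_smul, ContinuousLinearMap.smul_comp, ContinuousLinearMap.comp_smul,
      RingHom.id_apply]

/-- The operator `(A ⊗ I) P†`, through which `compression P` factors on products `A† B`. -/
def dilation (A : E →L[ℂ] E) : G →L[ℂ] HTensor E F := tensorId F A ∘L P.adjoint

theorem adjoint_dilation (A : E →L[ℂ] E) :
    (dilation P A).adjoint = P ∘L tensorId F A.adjoint := by
  rw [dilation, ContinuousLinearMap.adjoint_comp, ContinuousLinearMap.adjoint_adjoint,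
    tensorId_adjoint]

theorem adjoint_dilation_tensorBasis (A : E →L[ℂ] E) (b : HilbertBasis ι ℂ E)
    (c : HilbertBasis κ ℂ F) (p : ι × κ) :
    (dilation P A).adjoint (tensorBasis b c p) = P (htmul (A.adjoint (b p.1)) (c p.2)) := by
  rw [adjoint_dilation, tensorBasis_apply, ContinuousLinearMap.comp_apply, tensorId_htmul]

theorem compression_adjoint_comp (A B : E →L[ℂ] E) :
    compression P (A.adjoint ∘L B) = (dilation P A).adjoint ∘L dilation P B := by
  rw [adjoint_dilation, dilation, ContinuousLinearMap.comp_assoc,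
    ← ContinuousLinearMap.comp_assoc (tensorId F A.adjoint), ← tensorId_comp]
  rfl

theorem isCompletelyPositive_compression : IsCompletelyPositive (compression P) :=
  isCompletelyPositive_of_apply_adjoint_comp (dilation P) (compression_adjoint_comp P)

end Compression

section PartialTrace

theorem hasSum_inner_of_hasSum_norm_sq {𝕜 E F κ : Type*} [RCLike 𝕜] [NormedAddCommGroup E]
    [InnerProductSpace 𝕜 E] [NormedAddCommGroup F] [InnerProductSpace 𝕜 F] {T : κ → E →L[𝕜] F}
    {r : ℝ} (h : ∀ x, HasSum (fun j => ‖T j x‖ ^ 2) (r * ‖x‖ ^ 2)) (x y : E) :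
    HasSum (fun j => ⟪T j x, T j y⟫_𝕜) (r * ⟪x, y⟫_𝕜) := by
  have h' (x : E) : HasSum (fun j => (‖T j x‖ : 𝕜) ^ 2) (r * (‖x‖ : 𝕜) ^ 2) := by
    exact_mod_cast (RCLike.hasSum_ofReal 𝕜).2 (h x)
  have polarized := (((h' (x + y)).sub (h' (x - y))).add
    (((h' (x - (RCLike.I : 𝕜) • y)).sub (h' (x + (RCLike.I : 𝕜) • y))).mul_right
      RCLike.I)).div_const 4
  simp only [map_add, map_sub, map_smul, ← inner_eq_sum_norm_sq_div_four] at polarized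
  convert polarized using 1
  rw [inner_eq_sum_norm_sq_div_four]
  ring

variable {E F G ι κ : Type} [NormedAddCommGroup E] [InnerProductSpace ℂ E]
  [NormedAddCommGroup F] [InnerProductSpace ℂ F]
  [NormedAddCommGroup G] [InnerProductSpace ℂ G]
  {P : HTensor E F →L[ℂ] G} {c : HilbertBasis κ ℂ F} {r : ℝ}

/-- The partial trace of `P† P` over the second tensor factor is `r • I`, expressed as
`∑ j, ‖P (x ⊗ c j)‖² = r ‖x‖²` in a Hilbert basis `c` of that factor. -/
def HasScalarPartialTrace (P : HTensor E F →L[ℂ] G) (c : HilbertBasis κ ℂ F) (r : ℝ) : Prop :=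
  ∀ x : E, HasSum (fun j => ‖P (htmul x (c j))‖ ^ 2) (r * ‖x‖ ^ 2)

theorem hasScalarPartialTrace_of_pairwise_orthogonal (b : HilbertBasis ι ℂ E)
    (orthogonal : ∀ j, Pairwise fun i i' =>
      ⟪P (htmul (b i) (c j)), P (htmul (b i') (c j))⟫_ℂ = 0)
    (hr : ∀ i, HasSum (fun j => ‖P (htmul (b i) (c j))‖ ^ 2) r) : HasScalarPartialTrace P c r := by
  intro x
  have rows (j : κ) : HasSum (fun i => ‖⟪b i, x⟫_ℂ‖ ^ 2 * ‖P (htmul (b i) (c j))‖ ^ 2)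
      (‖P (htmul x (c j))‖ ^ 2) :=
    hasSum_norm_apply_sq_of_pairwise_orthogonal b (P ∘L htmulRight E (c j)) (orthogonal j) x
  have columns (i : ι) : HasSum (fun j => ‖⟪b i, x⟫_ℂ‖ ^ 2 * ‖P (htmul (b i) (c j))‖ ^ 2)
      (‖⟪b i, x⟫_ℂ‖ ^ 2 * r) := (hr i).mul_left _
  have total : HasSum (fun i => ‖⟪b i, x⟫_ℂ‖ ^ 2 * r) (r * ‖x‖ ^ 2) := by
    simpa only [mul_comm] using (hasSum_norm_inner_sq b x).mul_left r
  have summable : Summable fun p : ι × κ =>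
      ‖⟪b p.1, x⟫_ℂ‖ ^ 2 * ‖P (htmul (b p.1) (c p.2))‖ ^ 2 := by
    refine (summable_prod_of_nonneg fun p => by positivity).2 ⟨fun i => (columns i).summable, ?_⟩
    simpa only [fun i => (columns i).tsum_eq] using total.summable
  have double := summable.hasSum
  rw [← total.unique (double.prod_fiberwise columns)] at double
  exact ((Equiv.prodComm κ ι).hasSum_iff.2 double).prod_fiberwise rows

namespace HasScalarPartialTrace

theorem hasSum_inner (h : HasScalarPartialTrace P c r) (x y : E) :
    HasSum (fun j => ⟪P (htmul x (c j)), P (htmul y (c j))⟫_ℂ) (r * ⟪x, y⟫_ℂ) :=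
  hasSum_inner_of_hasSum_norm_sq (T := fun j => P ∘L htmulRight E (c j)) h x y

variable [CompleteSpace E] [CompleteSpace G]

theorem isHilbertSchmidt_dilation (h : HasScalarPartialTrace P c r) {A : E →L[ℂ] E}
    (hA : IsHilbertSchmidt A) : IsHilbertSchmidt (dilation P A) := by
  obtain ⟨s, b, -⟩ := exists_hilbertBasis ℂ E
  rw [← (dilation P A).adjoint_adjoint]
  refine IsHilbertSchmidt.adjoint ((isHilbertSchmidt_iff_summable (tensorBasis b c)).2 ?_)
  simp only [adjoint_dilation_tensorBasis]
  refine (summable_prod_of_nonneg fun p => sq_nonneg _).2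
    ⟨fun i => (h (A.adjoint (b i))).summable, ?_⟩
  simp only [fun i => (h (A.adjoint (b i))).tsum_eq]
  exact (hA.adjoint s b).mul_left r

theorem isTraceClass_compression (h : HasScalarPartialTrace P c r) {A : E →L[ℂ] E}
    (hA : IsTraceClass A) : IsTraceClass (compression P A) := by
  obtain ⟨B, C, hB, hC, rfl⟩ := hA.exists_eq_adjoint_comp
  rw [compression_adjoint_comp]
  exact (h.isHilbertSchmidt_dilation hB).isTraceClass_adjoint_comp (h.isHilbertSchmidt_dilation hC)

theorem hasTrace_compression (h : HasScalarPartialTrace P c r) {A : E →L[ℂ] E}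
    (hA : IsTraceClass A) {t : ℂ} (ht : HasTrace A t) :
    HasTrace (compression P A) (r * t) := by
  obtain ⟨B, C, hB, hC, rfl⟩ := hA.exists_eq_adjoint_comp
  obtain ⟨s, b, -⟩ := exists_hilbertBasis ℂ E
  obtain ⟨_, d, -⟩ := exists_hilbertBasis ℂ G
  have hB' := h.isHilbertSchmidt_dilation hB
  have hC' := h.isHilbertSchmidt_dilation hC
  rw [compression_adjoint_comp, hB'.hasTrace_adjoint_comp_iff hC' (tensorBasis b c)]
  obtain ⟨t', -, ht'⟩ := hB'.exists_hasSum_inner hC' d (tensorBasis b c)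
  have fiberwise := ht'
  simp only [adjoint_dilation_tensorBasis] at fiberwise
  have sum_fibers := fiberwise.prod_fiberwise fun i =>
    h.hasSum_inner (C.adjoint (b i)) (B.adjoint (b i))
  rwa [sum_fibers.unique (((hB.hasTrace_adjoint_comp_iff hC b).1 ht).mul_left (r : ℂ))] at ht'

end HasScalarPartialTrace

end PartialTrace

section Growth

open Filter Topology Asymptotics

theorem hasSum_of_telescope {f g H : ℕ → ℝ} {s : ℝ} (hf : HasSum f s) (hg : ∀ n, 0 ≤ g n)
    (h : ∀ n, g n = f n + (H n - H (n + 1))) (hH : Tendsto H atTop (𝓝 0)) :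
    HasSum g (s + H 0) := by
  have partial_sums (n : ℕ) : ∑ i ∈ Finset.range n, g i =
      ∑ i ∈ Finset.range n, f i + (H 0 - H n) := by
    simp only [h, Finset.sum_add_distrib, Finset.sum_range_sub']
  rw [hasSum_iff_tendsto_nat_of_nonneg hg]
  simpa only [partial_sums, sub_zero] using hf.tendsto_sum_nat.add (hH.const_sub (H 0))

theorem tendsto_zero_of_isBigO_pow_div_pow {i j : ℕ} (hij : i < j) {f : ℕ → ℝ}
    (hf : f =O[atTop] fun n => (n : ℝ) ^ i / (n : ℝ) ^ j) : Tendsto f atTop (𝓝 0) :=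
  hf.trans_tendsto ((tendsto_pow_div_pow_atTop_zero hij).comp tendsto_natCast_atTop_atTop)

theorem isEquivalent_natCast_of_abs_sub_le {f : ℕ → ℕ} {C : ℝ} (h : ∀ n, |(f n : ℝ) - n| ≤ C) :
    (fun n => (f n : ℝ)) ~[atTop] fun n => (n : ℝ) := by
  have bounded : (fun n => (f n : ℝ) - n) =O[atTop] fun _ => (1 : ℝ) :=
    isBigO_of_le' (c := C) atTop fun n => by simpa using h n
  exact bounded.trans_isLittleO
    ((isLittleO_const_id_atTop (1 : ℝ)).comp_tendsto tendsto_natCast_atTop_atTop)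

theorem isTheta_wt_comp (p : ℕ) {f : ℕ → ℕ} {C : ℝ} (h : ∀ n, |(f n : ℝ) - n| ≤ C) :
    (fun n => wt (p + 1) (f n)) =Θ[atTop] fun n => (n : ℝ) ^ p := by
  have equivalent : (fun n => ((f n + p : ℕ) : ℝ)) ~[atTop] fun n => (n : ℝ) := by
    refine isEquivalent_natCast_of_abs_sub_le (C := C + p) fun n => ?_
    have := abs_le.1 (h n)
    have : (0 : ℝ) ≤ p := p.cast_nonneg
    push_cast
    exact abs_le.2 ⟨by linarith, by linarith⟩
  have tendsto_shift : Tendsto (fun n => f n + p) atTop atTop :=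
    tendsto_natCast_atTop_iff.1 (equivalent.symm.tendsto_atTop tendsto_natCast_atTop_atTop)
  simp only [wt_eq_choose]
  exact IsTheta.trans ⟨(isTheta_choose p).1.comp_tendsto tendsto_shift,
    (isTheta_choose p).2.comp_tendsto tendsto_shift⟩ (equivalent.pow p).isTheta

theorem isTheta_wt (p : ℕ) : wt (p + 1) =Θ[atTop] fun n => (n : ℝ) ^ p :=
  isTheta_wt_comp p (f := id) (C := 0) fun n => by simp

theorem isBigO_tau (μ ν k a : ℕ) : tau μ ν k a =O[atTop] fun b => (b : ℝ) ^ k := by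
  refine IsBigO.fun_sum (ι := ℕ) (s := Finset.range (k + 1)) fun j _ => ?_
  have descFactorial : (fun b : ℕ => (b.descFactorial (k - j) : ℝ)) =O[atTop]
      fun b => (b : ℝ) ^ k :=
    (isEquivalent_descFactorial (k - j)).isBigO.trans
      ((IsBigO.pow_of_le_right (eventually_ge_atTop 1) (k.sub_le j)).comp_tendsto
        tendsto_natCast_atTop_atTop)
  exact (descFactorial.const_mul_left _).const_mul_left _

end Growth

section GaussSum

open Filter Topology Asymptotics

theorem wt_zero_right (p : ℕ) : wt p 0 = 1 := by simp [wt]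

theorem wt_add_one_pos (p m : ℕ) : 0 < wt (p + 1) m := by
  rw [wt_eq_choose]
  exact_mod_cast Nat.choose_pos (Nat.le_add_left p m)

theorem wt_succ_left (p m : ℕ) : p * wt (p + 1) m = (p + m) * wt p m := by
  have h : (p * (p + 1).ascFactorial m : ℝ) = (p + m) * p.ascFactorial m := by
    exact_mod_cast Nat.succ_ascFactorial p m
  rw [wt, wt, ← mul_div_assoc, ← mul_div_assoc, h]

theorem wt_pascal (p m : ℕ) : wt (p + 1) (m + 1) = wt (p + 1) m + wt p (m + 1) := by
  have hm : (m : ℝ) + 1 ≠ 0 := by positivity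
  have left := wt_succ (p + 1) m
  push_cast at left
  apply mul_left_cancel₀ hm
  linear_combination left - wt_succ p m + wt_succ_left p m

theorem wt_div_wt_succ (b c m : ℕ) :
    (c + 1 + m) * (wt b (m + 1) / wt (c + 1) (m + 1)) =
      (b + m) * (wt b m / wt (c + 1) m) := by
  have hm : (m : ℝ) + 1 ≠ 0 := by positivity
  have numerator := wt_succ b m
  have denominator := wt_succ (c + 1) m
  push_cast at denominator
  rw [← mul_div_assoc, ← mul_div_assoc,
    div_eq_div_iff (wt_add_one_pos c (m + 1)).ne' (wt_add_one_pos c m).ne']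
  apply mul_left_cancel₀ hm
  linear_combination (c + 1 + m) * wt (c + 1) m * numerator - (b + m) * wt b m * denominator

/-- The boundary term of the summation by parts that lowers the parameter `p + 1` of Gauss's
series `₂F₁(p + 1, q + 1; p + q + d + 3; 1)` to `p`. -/
def gaussBoundary (p q d m : ℕ) : ℝ :=
  (p + q + d + 2 + m) * (wt (p + 1) m - wt p m) * (wt (q + 1) m / wt (p + q + d + 3) m)

theorem gaussBoundary_zero (p q d : ℕ) : gaussBoundary p q d 0 = 0 := by
  simp [gaussBoundary, wt_zero_right]

theorem gaussBoundary_succ (p q d m : ℕ) :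
    gaussBoundary p q d (m + 1) =
      (q + 1 + m) * (wt (p + 1) m * (wt (q + 1) m / wt (p + q + d + 3) m)) := by
  have ratio := wt_div_wt_succ (q + 1) (p + q + d + 2) m
  rw [gaussBoundary, wt_pascal p m]
  push_cast at ratio ⊢
  linear_combination wt (p + 1) m * ratio

theorem gauss_telescope (p q d m : ℕ) :
    (d + 1) * (wt (p + 1) m * (wt (q + 1) m / wt (p + q + d + 3) m)) =
      (q + d + 2) * (wt p m * (wt (q + 1) m / wt (p + q + d + 3) m)) +
        (gaussBoundary p q d m - gaussBoundary p q d (m + 1)) := by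
  rw [gaussBoundary_succ, gaussBoundary]
  linear_combination -(wt (q + 1) m / wt (p + q + d + 3) m) * wt_succ_left p m

theorem tendsto_gaussBoundary (p q d : ℕ) : Tendsto (gaussBoundary p q d) atTop (𝓝 0) := by
  rw [← tendsto_add_atTop_iff_nat 1]
  simp only [gaussBoundary_succ]
  refine tendsto_zero_of_isBigO_pow_div_pow (i := p + q + 1) (j := p + q + d + 2) (by omega) ?_
  have linear : (fun m : ℕ => ((q + 1 + m : ℕ) : ℝ)) =O[atTop] fun m => (m : ℝ) :=
    (isEquivalent_natCast_of_abs_sub_le (f := fun m => q + 1 + m) (C := q + 1) fun m => by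
      push_cast
      rw [add_sub_cancel_right, abs_of_nonneg (by positivity)]).isBigO
  have product := linear.mul
    ((isTheta_wt p).mul ((isTheta_wt q).div (isTheta_wt (p + q + d + 2)))).isBigO
  refine (product.congr_left fun m => ?_).congr_right fun m => ?_
  · push_cast
    rfl
  · ring

theorem gauss_value_succ (p q d : ℕ) :
    (d + 1 : ℝ) * ((p + 1 + q + d + 1).factorial * d.factorial /
        ((q + d + 1).factorial * (p + 1 + d).factorial)) =
      (q + d + 2) * ((p + q + (d + 1) + 1).factorial * (d + 1).factorial /
        ((q + (d + 1) + 1).factorial * (p + (d + 1)).factorial)) := by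
  rw [show p + 1 + q + d + 1 = p + q + (d + 1) + 1 by ring,
    show q + (d + 1) + 1 = q + d + 1 + 1 by ring, show p + 1 + d = p + (d + 1) by ring,
    Nat.factorial_succ (q + d + 1), Nat.factorial_succ d]
  push_cast
  field_simp
  ring

theorem hasSum_gauss (p q d : ℕ) :
    HasSum (fun m => wt p m * (wt (q + 1) m / wt (p + q + d + 2) m))
      ((p + q + d + 1).factorial * d.factorial / ((q + d + 1).factorial * (p + d).factorial)) := by
  induction p generalizing d with
  | zero =>
    have vanish (m : ℕ) (hm : m ≠ 0) : wt 0 m = 0 := by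
      obtain ⟨m, rfl⟩ := Nat.exists_eq_succ_of_ne_zero hm
      simp [wt, Nat.zero_ascFactorial]
    convert hasSum_single (α := ℝ) (f := fun m =>
      wt 0 m * (wt (q + 1) m / wt (0 + q + d + 2) m)) 0 fun m hm => by simp [vanish m hm] using 1
    simp only [wt_zero_right, zero_add]
    field_simp
  | succ p ih =>
    have hd : (d : ℝ) + 1 ≠ 0 := by positivity
    have nonneg (m : ℕ) :
        0 ≤ (d + 1) * (wt (p + 1) m * (wt (q + 1) m / wt (p + q + d + 3) m)) := by
      have := wt_add_one_pos p m
      have := wt_add_one_pos q m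
      have := wt_add_one_pos (p + q + d + 2) m
      positivity
    have scaled := hasSum_of_telescope ((ih (d + 1)).mul_left ((q : ℝ) + d + 2)) nonneg
      (gauss_telescope p q d) (tendsto_gaussBoundary p q d)
    rw [gaussBoundary_zero, add_zero, ← gauss_value_succ] at scaled
    rw [show p + 1 + q + d + 2 = p + q + d + 3 by ring]
    exact (hasSum_mul_left_iff hd).1 scaled

end GaussSum

section TransvectantSum

open Filter Topology Asymptotics

theorem tau_eq_zero (μ ν : ℕ) {k a b : ℕ} (h : a + b < k) : tau μ ν k a b = 0 := by
  refine Finset.sum_eq_zero fun j _ => ?_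
  rcases lt_or_ge a j with ha | ha
  · simp [Nat.descFactorial_eq_zero_iff_lt.2 ha]
  · simp [Nat.descFactorial_eq_zero_iff_lt.2 (show b < k - j by omega)]

theorem tau_zero_left (μ ν k b : ℕ) :
    tau μ ν k 0 b = b.descFactorial k / ν.ascFactorial k := by
  rw [tau, Finset.sum_eq_single_of_mem 0 (by simp)]
  · simp only [tcoef, pow_zero, Nat.choose_zero_right, Nat.ascFactorial_zero,
      Nat.descFactorial_zero, Nat.sub_zero, Nat.cast_one, one_mul]
    ring
  · intro j _ hj
    simp [Nat.descFactorial_eq_zero_iff_lt.2 (Nat.pos_of_ne_zero hj)]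

/-- The weight of `z ^ a ⊗ w ^ b` in `𝓗_μ ⊗ 𝓗_ν` relative to that of its image, a multiple of
`ζ ^ (a + b - k)`, in `𝓗_{μ+ν+2k}`. Meaningful for `k ≤ a + b`; below that degree the image is
zero. -/
def relWt (μ ν k a b : ℕ) : ℝ := wt μ a * wt ν b / wt (μ + ν + 2 * k) (a + b - k)

theorem relWt_comm (μ ν k a b : ℕ) : relWt μ ν k a b = relWt ν μ k b a := by
  rw [relWt, relWt, mul_comm, add_comm μ, add_comm a]

theorem isBigO_relWt (μ ν k a : ℕ) [hν : Fact (1 < ν)] :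
    relWt μ ν k a =O[atTop] fun b => (b : ℝ) ^ (ν - 1) / (b : ℝ) ^ (μ + ν + 2 * k - 1) := by
  have shift (b : ℕ) : |((a + b - k : ℕ) : ℝ) - b| ≤ a + k := by
    have upper : ((a + b - k : ℕ) : ℝ) ≤ a + b := by exact_mod_cast Nat.sub_le (a + b) k
    have lower : (b : ℝ) ≤ (a + b - k : ℕ) + k := by
      exact_mod_cast show b ≤ a + b - k + k by omega
    have : (0 : ℝ) ≤ a := a.cast_nonneg
    have : (0 : ℝ) ≤ k := k.cast_nonneg
    exact abs_le.2 ⟨by linarith, by linarith⟩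
  have source := isTheta_wt (ν - 1)
  have target := isTheta_wt_comp (μ + ν + 2 * k - 1) shift
  have : 1 < ν := hν.out
  rw [Nat.sub_add_cancel (by omega)] at source target
  refine ((source.div target).isBigO.const_mul_left (wt μ a)).congr_left fun b => ?_
  rw [relWt, mul_div_assoc]

/-- The boundary term in the telescoping comparison of the column sums
`∑ b, tau μ ν k a b ^ 2 * relWt μ ν k a b` for `a` and `a + 1`. -/
def tauBoundary (μ ν k a b : ℕ) : ℝ :=
  b / (a + 1) * relWt μ ν k a b * (tau μ ν k (a + 1) (b - 1) * tau μ ν k a b)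

theorem tauBoundary_zero (μ ν k a : ℕ) : tauBoundary μ ν k a 0 = 0 := by
  simp [tauBoundary]

theorem tendsto_tauBoundary (μ ν k a : ℕ) [hμ : Fact (1 < μ)] [hν : Fact (1 < ν)] :
    Tendsto (tauBoundary μ ν k a) atTop (𝓝 0) := by
  have pred : (fun b : ℕ => (((b - 1 : ℕ) : ℝ)) ^ k) =O[atTop] fun b => (b : ℝ) ^ k :=
    isBigO_of_le _ fun b => by
      rw [Real.norm_of_nonneg (by positivity), Real.norm_of_nonneg (by positivity)]
      gcongr
      exact b.sub_le 1
  have tau_pred : (fun b => tau μ ν k (a + 1) (b - 1)) =O[atTop] fun b => (b : ℝ) ^ k :=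
    ((isBigO_tau μ ν k (a + 1)).comp_tendsto (tendsto_sub_atTop_nat 1)).trans pred
  have linear : (fun b : ℕ => (b : ℝ) / (a + 1)) =O[atTop] fun b => (b : ℝ) := by
    simpa only [div_eq_inv_mul] using (isBigO_refl (fun b : ℕ => (b : ℝ)) atTop).const_mul_left _
  have product := (linear.mul (isBigO_relWt μ ν k a)).mul (tau_pred.mul (isBigO_tau μ ν k a))
  have := hμ.out
  have := hν.out
  refine tendsto_zero_of_isBigO_pow_div_pow (i := 1 + (ν - 1) + k + k)
    (j := μ + ν + 2 * k - 1) (by omega) (product.congr_right fun b => ?_)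
  ring

theorem relWt_succ_left (μ ν k : ℕ) {a b : ℕ} [Fact (1 < μ)] (h : k ≤ a + b) :
    (a + 1) * (a + b + μ + ν + k) * relWt μ ν k (a + 1) b =
      (μ + a) * (a + b + 1 - k) * relWt μ ν k a b := by
  obtain ⟨n, hn⟩ := Nat.exists_eq_add_of_le' h
  have hn' : (a : ℝ) + b = n + k := by exact_mod_cast hn
  have source := wt_succ μ a
  have target := wt_succ (μ + ν + 2 * k) n
  push_cast at target
  rw [relWt, relWt, show a + b - k = n by omega, show a + 1 + b - k = n + 1 by omega,
    ← mul_div_assoc, ← mul_div_assoc,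
    div_eq_div_iff (wt_pos (μ + ν + 2 * k) (n + 1)).ne' (wt_pos (μ + ν + 2 * k) n).ne', hn']
  linear_combination (n + k + μ + ν + k) * wt ν b * wt (μ + ν + 2 * k) n * source -
    (μ + a) * wt μ a * wt ν b * target

theorem relWt_succ_right (μ ν k : ℕ) {a b : ℕ} [Fact (1 < ν)] (h : k ≤ a + b) :
    (b + 1) * (a + b + μ + ν + k) * relWt μ ν k a (b + 1) =
      (ν + b) * (a + b + 1 - k) * relWt μ ν k a b := by
  rw [relWt_comm μ, relWt_comm μ]
  linear_combination relWt_succ_left ν μ k (show k ≤ b + a by omega)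

section Telescope

variable (μ ν k a b : ℕ) [Fact (1 < μ)] [Fact (1 < ν)]

theorem relWt_pos : 0 < relWt μ ν k a b :=
  div_pos (mul_pos (wt_pos μ a) (wt_pos ν b)) (wt_pos (μ + ν + 2 * k) (a + b - k))

theorem tau_sq_telescope_of_lt {a b : ℕ} (h : a + b < k) :
    tau μ ν k (a + 1) b ^ 2 * relWt μ ν k (a + 1) b =
      tau μ ν k a b ^ 2 * relWt μ ν k a b +
        (tauBoundary μ ν k a b - tauBoundary μ ν k a (b + 1)) := by
  have raise := tau_raise μ ν k a b
  rw [tauBoundary, tauBoundary, Nat.add_sub_cancel]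
  push_cast
  rw [tau_eq_zero μ ν h] at raise ⊢
  rcases (Nat.succ_le_of_lt h).lt_or_eq with below | edge
  · rw [tau_eq_zero μ ν (show a + 1 + b < k by omega)]
    ring
  · rw [relWt, relWt, relWt, show a + 1 + b - k = 0 by omega,
      show a + (b + 1) - k = 0 by omega, wt_zero_right]
    field_simp
    linear_combination tau μ ν k (a + 1) b ^ 2 * wt ν b * wt_succ μ a +
      wt μ a * tau μ ν k a (b + 1) * tau μ ν k (a + 1) b * wt_succ ν b +
      wt μ a * wt ν b * tau μ ν k (a + 1) b * raise

theorem tau_sq_telescope_of_le {a b : ℕ} (h : k ≤ a + b) :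
    tau μ ν k (a + 1) b ^ 2 * relWt μ ν k (a + 1) b =
      tau μ ν k a b ^ 2 * relWt μ ν k a b +
        (tauBoundary μ ν k a b - tauBoundary μ ν k a (b + 1)) := by
  have raise := tau_raise μ ν k a b
  have lower := tau_lower μ ν k (a + 1) b
  rw [Nat.add_sub_cancel] at lower
  rw [tauBoundary, tauBoundary, Nat.add_sub_cancel]
  push_cast at lower ⊢
  have hμ : (1 : ℝ) < μ := by exact_mod_cast (Fact.out : 1 < μ)
  have hM : (a : ℝ) + b + μ + ν + k ≠ 0 := by positivity
  field_simp
  apply mul_left_cancel₀ hM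
  linear_combination tau μ ν k (a + 1) b ^ 2 * relWt_succ_left μ ν k h +
    tau μ ν k (a + 1) b * tau μ ν k a (b + 1) * relWt_succ_right μ ν k h +
    relWt μ ν k a b * (a + b + 1 - k) * tau μ ν k (a + 1) b * raise -
    relWt μ ν k a b * (a + b + μ + ν + k) * tau μ ν k a b * lower

theorem tau_sq_telescope :
    tau μ ν k (a + 1) b ^ 2 * relWt μ ν k (a + 1) b =
      tau μ ν k a b ^ 2 * relWt μ ν k a b +
        (tauBoundary μ ν k a b - tauBoundary μ ν k a (b + 1)) :=
  (lt_or_ge (a + b) k).elim (tau_sq_telescope_of_lt μ ν k) (tau_sq_telescope_of_le μ ν k)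

end Telescope

theorem ascFactorial_mul_wt (ν k m : ℕ) :
    ν.ascFactorial k * (wt (ν + k) m * m.factorial) = wt ν (m + k) * (m + k).factorial := by
  have hm : (m.factorial : ℝ) ≠ 0 := by positivity
  have hmk : ((m + k).factorial : ℝ) ≠ 0 := by positivity
  rw [wt, wt, div_mul_cancel₀ _ hm, div_mul_cancel₀ _ hmk, add_comm m k]
  exact_mod_cast Nat.ascFactorial_mul_ascFactorial ν k m

theorem descFactorial_eq_factorial_mul_wt (k m : ℕ) :
    ((m + k).descFactorial k : ℝ) = k.factorial * wt (k + 1) m := by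
  rw [wt_eq_choose, Nat.descFactorial_eq_factorial_mul_choose]
  push_cast
  rfl

theorem tau_sq_zero_left (μ ν k m : ℕ) [Fact (1 < μ)] [Fact (1 < ν)] :
    tau μ ν k 0 (m + k) ^ 2 * relWt μ ν k 0 (m + k) =
      k.factorial / ν.ascFactorial k *
        (wt (k + 1) m * (wt (ν + k) m / wt (μ + ν + 2 * k) m)) := by
  have hν := (asc_pos ν k).ne'
  have hw := (wt_pos (μ + ν + 2 * k) m).ne'
  have hm : (m.factorial : ℝ) ≠ 0 := by positivity
  have descFactorial_mul : ((m + k).descFactorial k : ℝ) * m.factorial = (m + k).factorial := by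
    have := Nat.factorial_mul_descFactorial (Nat.le_add_left k m)
    rw [Nat.add_sub_cancel, mul_comm] at this
    exact_mod_cast this
  have weights : (ν.ascFactorial k : ℝ) * wt (ν + k) m =
      wt ν (m + k) * (m + k).descFactorial k := by
    apply mul_right_cancel₀ hm
    linear_combination ascFactorial_mul_wt ν k m - wt ν (m + k) * descFactorial_mul
  rw [tau_zero_left, relWt, wt_zero_right, one_mul, zero_add, Nat.add_sub_cancel]
  field_simp
  linear_combination -((m + k).descFactorial k : ℝ) * weights +
    ν.ascFactorial k * wt (ν + k) m * descFactorial_eq_factorial_mul_wt k m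

theorem cast_succ_ascFactorial (n k : ℕ) :
    ((n + 1).ascFactorial k : ℝ) = (n + k).factorial / n.factorial := by
  rw [eq_div_iff (by positivity), mul_comm]
  exact_mod_cast Nat.factorial_mul_ascFactorial n k

theorem cst_sq_mul_gauss_value (m n k : ℕ) :
    cst (m + 2) (n + 1) k ^ 2 * (k.factorial / (n + 1).ascFactorial k *
      ((k + 1 + (n + k) + m + 1).factorial * m.factorial /
        ((n + k + m + 1).factorial * (k + 1 + m).factorial))) =
      (m + n + 2 * k + 2) / (m + 1) := by
  rw [cst, Real.sq_sqrt (by positivity), show m + 2 + (n + 1) + k - 1 = m + n + k + 1 + 1 by omega,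
    cast_succ_ascFactorial n, cast_succ_ascFactorial (m + 1),
    cast_succ_ascFactorial (m + n + k + 1),
    show k + 1 + (n + k) + m + 1 = m + n + k + 1 + k + 1 by ring,
    Nat.factorial_succ (m + n + k + 1 + k), show m + 1 + k = k + 1 + m by ring,
    show n + k + m + 1 = m + n + k + 1 by ring, Nat.factorial_succ m]
  push_cast
  field_simp
  ring

theorem hasSum_tau_sq_zero (μ ν k : ℕ) [hμ : Fact (1 < μ)] [hν : Fact (1 < ν)] :
    HasSum (fun b => cst μ ν k ^ 2 * (tau μ ν k 0 b ^ 2 * relWt μ ν k 0 b))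
      ((μ + ν + 2 * k - 1) / (μ - 1)) := by
  have vanish : ∀ b ∉ Set.range (· + k),
      cst μ ν k ^ 2 * (tau μ ν k 0 b ^ 2 * relWt μ ν k 0 b) = 0 := fun b hb => by
    have hbk : 0 + b < k := by
      by_contra h
      exact hb ⟨b - k, Nat.sub_add_cancel (by omega)⟩
    simp [tau_eq_zero μ ν hbk]
  rw [← (add_left_injective k).hasSum_iff vanish]
  simp only [Function.comp_def, tau_sq_zero_left]
  obtain ⟨m, rfl⟩ := Nat.exists_eq_add_of_le' hμ.out
  obtain ⟨n, rfl⟩ := Nat.exists_eq_add_of_le' hν.out.le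
  have gauss := ((hasSum_gauss (k + 1) (n + k) m).mul_left
    (k.factorial / (n + 1).ascFactorial k : ℝ)).mul_left (cst (m + 2) (n + 1) k ^ 2)
  rw [cst_sq_mul_gauss_value, show k + 1 + (n + k) + m + 2 = m + 2 + (n + 1) + 2 * k by ring,
    show n + k + 1 = n + 1 + k by ring] at gauss
  have value : (m + n + 2 * k + 2 : ℝ) / (m + 1) =
      ((m + 2 : ℕ) + (n + 1 : ℕ) + 2 * k - 1) / ((m + 2 : ℕ) - 1) := by
    push_cast
    ring
  rwa [← value]

theorem hasSum_tau_sq (μ ν k a : ℕ) [Fact (1 < μ)] [Fact (1 < ν)] :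
    HasSum (fun b => cst μ ν k ^ 2 * (tau μ ν k a b ^ 2 * relWt μ ν k a b))
      ((μ + ν + 2 * k - 1) / (μ - 1)) := by
  induction a with
  | zero => exact hasSum_tau_sq_zero μ ν k
  | succ a ih =>
    have telescoped := hasSum_of_telescope ih
      (fun b => mul_nonneg (sq_nonneg _) (mul_nonneg (sq_nonneg _) (relWt_pos μ ν k (a + 1) b).le))
      (fun b => by rw [tau_sq_telescope, mul_add, mul_sub])
      (by simpa only [mul_zero] using (tendsto_tauBoundary μ ν k a).const_mul (cst μ ν k ^ 2))
    rwa [tauBoundary_zero, mul_zero, add_zero] at telescoped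

end TransvectantSum

section Projection

variable (μ ν k : ℕ) [Fact (1 < μ)] [Fact (1 < ν)]

theorem proj_eq_adjoint_emb : proj μ ν k = (emb μ ν k).toContinuousLinearMap.adjoint := by
  refine htensor_ext fun f g => DFunLike.ext _ _ fun ζ => ?_
  by_cases hζ : ζ ∈ 𝔻
  · rw [proj_htmul μ ν k f g ζ hζ, adjoint_emb_apply f g hζ]
  · rw [eq_zero_of_notMem _ hζ, eq_zero_of_notMem _ hζ]

theorem proj_htmul_e (a b : ℕ) :
    proj μ ν k (htmul (e μ a) (e ν b)) =
      ((cst μ ν k * tau μ ν k a b * √(relWt μ ν k a b) : ℝ) : ℂ) •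
        e (μ + ν + 2 * k) (a + b - k) := by
  rw [proj_eq_adjoint_emb, adjoint_emb_htmul]
  split_ifs with h
  · rfl
  · simp [tau_eq_zero μ ν (not_le.1 h)]

theorem norm_proj_htmul_e_sq (a b : ℕ) :
    ‖proj μ ν k (htmul (e μ a) (e ν b))‖ ^ 2 =
      cst μ ν k ^ 2 * (tau μ ν k a b ^ 2 * relWt μ ν k a b) := by
  rw [proj_htmul_e, norm_smul, (orthonormal_e (μ + ν + 2 * k)).1, mul_one, Complex.norm_real,
    Real.norm_eq_abs, sq_abs, mul_pow, mul_pow, Real.sq_sqrt (relWt_pos μ ν k a b).le, mul_assoc]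

theorem inner_proj_htmul_e_of_ne {a a' : ℕ} (h : a ≠ a') (b : ℕ) :
    ⟪proj μ ν k (htmul (e μ a) (e ν b)), proj μ ν k (htmul (e μ a') (e ν b))⟫_ℂ = 0 := by
  rw [proj_htmul_e, proj_htmul_e, inner_smul_left, inner_smul_right]
  rcases lt_or_ge (a + b) k with ha | ha
  · simp [tau_eq_zero μ ν ha]
  rcases lt_or_ge (a' + b) k with ha' | ha'
  · simp [tau_eq_zero μ ν ha']
  rw [(orthonormal_e (μ + ν + 2 * k)).2 (show a + b - k ≠ a' + b - k by omega), mul_zero, mul_zero]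

theorem hasScalarPartialTrace_proj :
    HasScalarPartialTrace (proj μ ν k) (basis ν) ((μ + ν + 2 * k - 1) / (μ - 1)) := by
  refine hasScalarPartialTrace_of_pairwise_orthogonal (basis μ) (fun b a a' h => ?_) fun a => ?_
  · simpa only [basis_apply] using inner_proj_htmul_e_of_ne μ ν k h b
  · simpa only [basis_apply, norm_proj_htmul_e_sq] using hasSum_tau_sq μ ν k a

end Projection

end SU11

end

theorem mainTheorem6 (μ ν k : ℕ) [Fact (1 < μ)] [Fact (1 < ν)] :
    SU11.IsCompletelyPositive (SU11.channel μ ν k) ∧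
      ∀ A : SU11.Bergman μ →L[ℂ] SU11.Bergman μ, SU11.IsTraceClass A →
        SU11.IsTraceClass (SU11.channel μ ν k A) ∧
          ∃ t : ℂ, SU11.HasTrace A t ∧
            SU11.HasTrace (SU11.channel μ ν k A) (((μ : ℂ) + ν + 2 * k - 1) / (μ - 1) * t) := by
  have partialTrace := SU11.hasScalarPartialTrace_proj μ ν k
  refine ⟨SU11.isCompletelyPositive_compression (SU11.proj μ ν k), fun A hA => ?_⟩
  obtain ⟨t, ht⟩ := hA.exists_hasTrace
  have trace := partialTrace.hasTrace_compression hA ht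
  push_cast at trace
  exact ⟨partialTrace.isTraceClass_compression hA, t, ht, trace⟩
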